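/- Let $\mathbb D$ be the open unit disc, $n$ a natural number, and let $\lambda_1,\dots,\lambda_n$ be real numbers with $\lambda_i\ge 1$ for $1\le i\le n$ and $\lambda_i\le\lambda_{i+1}<\lambda_i+2$ for $1\le i\le n-1$. Let $\mathcal H_i$ be the reproducing kernel Hilbert space of functions on $\mathbb D$ with kernel $K_i(z,w)=(1-z\bar w)^{-\lambda_i}$. For $1\le i\le n-1$ let $\psi_{i,i+1}$ be a function that is continuous on $\overline{\mathbb D}$, holomorphic on $\mathbb D$ and not identically zero, and for $1\le i<j\le n$ with $j-i\ge 2$ let $\phi_{i,j}$ be a bounded holomorphic function on $\mathbb D$. For $i\le j$ and a function $f$ on $\mathbb D$ let $M_f:\mathcal H_i\to\mathcal H_j$, $g\mapsto fg$, be the multiplication operator, and write $M_{i,z}$ for multiplication by the coordinate function $z$ on $\mathcal H_i$. Then all of $M_{i,z}:\mathcal H_i\to\mathcal H_i$, $M_{\psi_{i,i+1}}:\mathcal H_i\to\mathcal H_{i+1}$ and $M_{\phi_{i,j}}:\mathcal H_i\to\mathcal H_j$ are well-defined bounded operators. Let $T$ be the bounded operator on $\mathcal H_1\oplus\cdots\oplus\mathcal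 H_n$ given by the upper-triangular $n\times n$ operator matrix with diagonal entries $M_{i,z}^*$, entries $M_{\psi_{i,i+1}}^*$ in the positions $(i,i+1)$, entries $M_{\phi_{i,j}}^*$ in the positions $(i,j)$ with $j-i\ge 2$, and $0$ below the diagonal. Then $T$ is weakly homogeneous if and only if every $\psi_{i,i+1}$, $1\le i\le n-1$, has no zero in $\overline{\mathbb D}$. Here a bounded operator $T$ is called weakly homogeneous if its spectrum satisfies $\sigma(T)\subseteq\overline{\mathbb D}$ and, for every Möbius map $\phi(z)=c\,\frac{z-a}{1-\bar a z}$ of the disc ($|c|=1$, $|a|<1$), the operator $\phi(T)=c\,(T-aI)(I-\bar aT)^{-1}$ is similar to $T$, that is, $\phi(T)=XTX^{-1}$ for some bounded invertible operator $X$. -/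

import Mathlib

open Metric
open scoped ComplexConjugate

/-- The matrix `(z, w) ↦ 1 / (1 - z w̄) ^ lam` on the open unit disc (principal branch of the power;
note `Re (1 - z w̄) > 0`). A complex number stands for the operator of multiplication by it. -/
noncomputable def discKernel (lam : ℝ) :
    Matrix (ball (0 : ℂ) 1) (ball (0 : ℂ) 1) (ℂ →L[ℂ] ℂ) :=
  Matrix.of fun z w => (1 / (1 - (z : ℂ) * conj (w : ℂ)) ^ (lam : ℂ)) • ContinuousLinearMap.id ℂ ℂ

theorem ringChoose_nonneg {lam : ℝ} (h : 0 < lam) (n : ℕ) :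
    0 ≤ Ring.choose (lam + n - 1) n := by
  have h1 : (n.factorial : ℝ) * Ring.choose (lam + n - 1) n =
      (ascPochhammer ℝ n).eval lam := by
    rw [← Polynomial.ascPochhammer_smeval_eq_eval, ← nsmul_eq_mul, ← Ring.multichoose_eq,
      Ring.factorial_nsmul_multichoose_eq_ascPochhammer, Polynomial.ascPochhammer_smeval_cast]
  have h2 := ascPochhammer_pos n lam h
  have h3 : (0 : ℝ) < n.factorial := by positivity
  rw [← h1] at h2
  exact (pos_of_mul_pos_right h2 h3.le).le

theorem hasSum_discKernel (lam : ℝ) (z w : ball (0 : ℂ) 1) :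
    HasSum (fun n : ℕ => ((Ring.choose (lam + n - 1) n : ℝ) : ℂ) * ((z : ℂ) ^ n * conj (w : ℂ) ^ n))
      (1 / (1 - (z : ℂ) * conj (w : ℂ)) ^ (lam : ℂ)) := by
  have hz : ‖(z : ℂ)‖ < 1 := mem_ball_zero_iff.1 z.2
  have hw : ‖(w : ℂ)‖ < 1 := mem_ball_zero_iff.1 w.2
  have hzw : ‖(z : ℂ) * conj (w : ℂ)‖ < 1 := by
    rw [norm_mul, RCLike.norm_conj]
    nlinarith [norm_nonneg (z : ℂ), norm_nonneg (w : ℂ)]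
  have hm : (z : ℂ) * conj (w : ℂ) ∈ Metric.eball (0 : ℂ) 1 := by
    rw [← ENNReal.ofReal_one, Metric.eball_ofReal]
    simpa using hzw
  have := (Complex.one_div_one_sub_cpow_hasFPowerSeriesOnBall_zero (lam : ℂ)).hasSum hm
  simp only [zero_add] at this
  refine this.congr_fun ?_
  intro n
  rw [FormalMultilinearSeries.ofScalars_apply_eq, Complex.ofReal_choose]
  push_cast
  simp [mul_pow]

/-- The kernel is positive semidefinite. -/
theorem discKernel_posSemidef {lam : ℝ} (h : 0 < lam) : (discKernel lam).PosSemidef := by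
  have hconj (z w : ball (0 : ℂ) 1) : conj (1 / (1 - (z : ℂ) * conj (w : ℂ)) ^ (lam : ℂ)) =
      1 / (1 - (w : ℂ) * conj (z : ℂ)) ^ (lam : ℂ) := by
    have h1 := Complex.hasSum_conj'.2 (hasSum_discKernel lam z w)
    refine h1.unique ?_
    convert hasSum_discKernel lam w z using 2 with n
    simp [mul_comm]
  have tfae := (RKHS.posSemidef_tfae (K := discKernel lam)).out 0 2
  refine tfae.mpr ⟨?_, fun vv => ?_⟩
  · refine Matrix.IsHermitian.ext fun z w => ?_
    ext
    rw [discKernel, Matrix.of_apply, Matrix.of_apply, ← hconj w z,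
      ContinuousLinearMap.star_eq_adjoint, map_smulₛₗ]
    simp only [ContinuousLinearMap.adjoint_id]
  · have key : HasSum (fun n : ℕ => Ring.choose (lam + n - 1) n *
        ‖∑ x ∈ vv.support, conj (x : ℂ) ^ n * vv x‖ ^ 2)
        (RCLike.re (vv.sum fun x w => vv.sum fun x' w' => inner ℂ ((discKernel lam x' x) w) w')) := by
      have h2 : HasSum (fun n : ℕ => ∑ x ∈ vv.support, ∑ x' ∈ vv.support,
          ((Ring.choose (lam + n - 1) n : ℝ) : ℂ) * ((x : ℂ) ^ n * conj (x' : ℂ) ^ n)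
            * (conj (vv x) * vv x'))
          (vv.sum fun x w => vv.sum fun x' w' => inner ℂ ((discKernel lam x' x) w) w') := by
        refine hasSum_sum fun x _ => hasSum_sum fun x' _ => ?_
        have := (hasSum_discKernel lam x x').mul_right (conj (vv x) * vv x')
        have e : inner ℂ ((discKernel lam x' x) (vv x)) (vv x') =
            1 / (1 - (x : ℂ) * conj (x' : ℂ)) ^ (lam : ℂ) * (conj (vv x) * vv x') := by
          rw [← hconj x' x]
          simp [discKernel]
          ring
        rw [← e] at this
        exact this
      refine (Complex.hasSum_re h2).congr_fun fun n => ?_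
      have e : (∑ x ∈ vv.support, ∑ x' ∈ vv.support,
          ((Ring.choose (lam + n - 1) n : ℝ) : ℂ) * ((x : ℂ) ^ n * conj (x' : ℂ) ^ n)
            * (conj (vv x) * vv x')) = ((Ring.choose (lam + n - 1) n *
        ‖∑ x ∈ vv.support, conj (x : ℂ) ^ n * vv x‖ ^ 2 : ℝ) : ℂ) := by
        push_cast
        rw [← Complex.conj_mul', map_sum, Finset.sum_mul_sum, Finset.mul_sum]
        refine Finset.sum_congr rfl fun x _ => ?_
        rw [Finset.mul_sum]
        refine Finset.sum_congr rfl fun x' _ => ?_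
        simp
        ring
      rw [e, Complex.ofReal_re]
    exact key.nonneg fun n => mul_nonneg (ringChoose_nonneg h n) (by positivity)

/-- The reproducing kernel Hilbert space (of functions on the open unit disc) with kernel
`1 / (1 - z w̄) ^ lam`. -/
def DiscSpace (lam : ℝ) (h : 0 < lam) : Type :=
  letI : Fact (discKernel lam).PosSemidef := ⟨discKernel_posSemidef h⟩
  RKHS.OfKernel (discKernel lam)

namespace DiscSpace

variable (lam : ℝ) (h : 0 < lam)

noncomputable instance : NormedAddCommGroup (DiscSpace lam h) :=
  letI : Fact (discKernel lam).PosSemidef := ⟨discKernel_posSemidef h⟩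
  inferInstanceAs (NormedAddCommGroup (RKHS.OfKernel (discKernel lam)))

noncomputable instance : InnerProductSpace ℂ (DiscSpace lam h) :=
  letI : Fact (discKernel lam).PosSemidef := ⟨discKernel_posSemidef h⟩
  inferInstanceAs (InnerProductSpace ℂ (RKHS.OfKernel (discKernel lam)))

instance : CompleteSpace (DiscSpace lam h) :=
  letI : Fact (discKernel lam).PosSemidef := ⟨discKernel_posSemidef h⟩
  inferInstanceAs (CompleteSpace (RKHS.OfKernel (discKernel lam)))

noncomputable instance : RKHS ℂ (DiscSpace lam h) (ball (0 : ℂ) 1) ℂ :=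
  letI : Fact (discKernel lam).PosSemidef := ⟨discKernel_posSemidef h⟩
  inferInstanceAs (RKHS ℂ (RKHS.OfKernel (discKernel lam)) (ball (0 : ℂ) 1) ℂ)

theorem kernel_eq : RKHS.kernel (DiscSpace lam h) = discKernel lam :=
  letI : Fact (discKernel lam).PosSemidef := ⟨discKernel_posSemidef h⟩
  RKHS.OfKernel.kernel_ofKernel (K := discKernel lam)

end DiscSpace

section Multiplication

variable (H K : Type*) [NormedAddCommGroup H] [InnerProductSpace ℂ H] [NormedAddCommGroup K]
  [InnerProductSpace ℂ K] [RKHS ℂ H (ball (0 : ℂ) 1) ℂ] [RKHS ℂ K (ball (0 : ℂ) 1) ℂ]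

/-- `f` multiplies the functions of `H` into `K`, and the multiplication operator is bounded. -/
def IsMultiplier (f : ℂ → ℂ) : Prop :=
  ∃ M : H →L[ℂ] K, ∀ (g : H) (z : ball (0 : ℂ) 1), M g z = f z * g z

open Classical in
/-- The multiplication operator `M_f : H → K`, `g ↦ f g` (zero if `f` is not a multiplier). -/
noncomputable def mulOp (f : ℂ → ℂ) : H →L[ℂ] K :=
  if h : IsMultiplier H K f then h.choose else 0

end Multiplication

/-- The bounded operator on the Hilbert direct sum `H 0 ⊕ ⋯ ⊕ H (n - 1)` with block entries
`A i j : H j → H i`. -/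
noncomputable def blockOp {n : ℕ} (H : Fin n → Type*) [∀ i, NormedAddCommGroup (H i)]
    [∀ i, InnerProductSpace ℂ (H i)] (A : ∀ i j, H j →L[ℂ] H i) :
    PiLp 2 H →L[ℂ] PiLp 2 H :=
  ((PiLp.continuousLinearEquiv 2 ℂ H).symm : (∀ i, H i) →L[ℂ] PiLp 2 H).comp
    (ContinuousLinearMap.pi fun i => ∑ j, (A i j).comp (PiLp.proj 2 H j))

/-- The symbols of the block entries with `i ≤ j`: the coordinate function on the diagonal, the
prescribed function `f i j` above it. -/
def symbol {n : ℕ} (f : Fin n → Fin n → ℂ → ℂ) (i j : Fin n) (z : ℂ) : ℂ :=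
  if i = j then z else f i j z

/-- The upper triangular operator with `(i, j)` entry `(M_z)^*` for `i = j`, `(M_{f i j})^*`
for `i < j` and `0` for `i > j`, where `M_{f i j} : H i → H j`. -/
noncomputable def triangularOp {n : ℕ} (H : Fin n → Type*) [∀ i, NormedAddCommGroup (H i)]
    [∀ i, InnerProductSpace ℂ (H i)] [∀ i, CompleteSpace (H i)]
    [∀ i, RKHS ℂ (H i) (ball (0 : ℂ) 1) ℂ] (f : Fin n → Fin n → ℂ → ℂ) :
    PiLp 2 H →L[ℂ] PiLp 2 H :=
  blockOp H fun i j =>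
    if i ≤ j then ContinuousLinearMap.adjoint (mulOp (H i) (H j) (symbol f i j)) else 0

section WeaklyHomogeneous

variable {E : Type*} [NormedAddCommGroup E] [NormedSpace ℂ E]

/-- `φ(T) = c (T - a) (1 - ā T)⁻¹` for the Möbius map `φ(z) = c (z - a) / (1 - ā z)` of the disc
(`|c| = 1`, `|a| < 1`). The inverse exists if the spectrum of `T` lies in the closed disc. -/
noncomputable def moebiusOp (c a : ℂ) (T : E →L[ℂ] E) : E →L[ℂ] E :=
  c • ((T - a • 1) * Ring.inverse (1 - conj a • T))

/-- `T` is weakly homogeneous: its spectrum lies in the closed unit disc and `φ(T)` is similar to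
`T` (conjugate by an invertible bounded operator) for every Möbius map `φ` of the disc. -/
def WeaklyHomogeneous (T : E →L[ℂ] E) : Prop :=
  spectrum ℂ T ⊆ closedBall 0 1 ∧
    ∀ c a : ℂ, ‖c‖ = 1 → ‖a‖ < 1 → IsConj (moebiusOp c a T) T

end WeaklyHomogeneous

open Metric
open scoped ComplexConjugate InnerProductSpace

/-! The adjoint of `T` is multiplication on the direct sum by a lower triangular matrix `F` over the
ring of bounded holomorphic functions, with z on the diagonal and the ψ's just below it. Up to
conjugating the coefficients of the Möbius map φ, the adjoint of φ(T) is multiplication by φ(F),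
which has φ on the diagonal and φ'ψ just below. Composition with θ = φ⁻¹ is bounded and invertible
on each summand, so φ(F) may be replaced by a matrix `G` with z back on the diagonal and (φ'∘θ)(ψ∘θ)
just below. The factor φ'∘θ is bounded away from zero, and the question is when `F` and `G` give
similar operators (`exists_isConj_moebiusOp_iff`).

If no ψ vanishes on the closed disc, the subdiagonal entries of `F` and `G` are units. Over any
commutative ring, a lower triangular matrix with constant diagonal x and unit subdiagonal is
conjugate to x plus the shift, whatever its other entries are
(`Matrix.IsLowerTriangular.exists_conj`). The conjugating matrices are lower triangular, hence act
boundedly, because a bounded holomorphic function multiplies each space into those with larger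
exponent (`PosKernel.multiplier`).

Conversely, for m < l + 2 a nonzero multiplication operator is never the commutator of a bounded map
from exponent l to exponent m with multiplication by z (`DiscSpace.eq_zero_of_commutator`). This
forces every intertwiner of `F` and `G` to be lower triangular with multiplication operators on its
diagonal, and ties the two subdiagonals together through these bounded symbols. The outcome is |ψ∘θ|
≤ C|ψ| for every Möbius map θ, with C depending on θ. Since Möbius maps act transitively on the disc
and rotations on the circle, one zero would make ψ vanish identically
(`ne_zero_of_norm_comp_moebius_le`). -/

/-- The open unit disc as a type. -/
abbrev Disc : Type := ball (0 : ℂ) 1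

/-! ### Powers of the Szegő kernel and positive semidefinite kernels -/

/-- The kernel `1 / (1 - z w̄) ^ l` as a complex number. -/
noncomputable def scalarKernel (l : ℝ) (z w : Disc) : ℂ :=
  1 / (1 - (z : ℂ) * conj (w : ℂ)) ^ (l : ℂ)

/-- A complex kernel on the disc that is positive semidefinite. -/
def PosKernel (P : Disc → Disc → ℂ) : Prop :=
  ∀ (s : Finset Disc) (c : Disc → ℂ), 0 ≤ (∑ x ∈ s, ∑ y ∈ s, conj (c x) * c y * P x y).re

theorem Disc.norm_lt_one (z : Disc) : ‖(z : ℂ)‖ < 1 := mem_ball_zero_iff.1 z.2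

theorem Disc.norm_mul_conj_lt_one (z w : Disc) : ‖(z : ℂ) * conj (w : ℂ)‖ < 1 := by
  rw [norm_mul, RCLike.norm_conj]
  nlinarith [norm_nonneg (z : ℂ), norm_nonneg (w : ℂ), z.norm_lt_one, w.norm_lt_one]

theorem Disc.one_sub_mul_conj_ne_zero (z w : Disc) : 1 - (z : ℂ) * conj (w : ℂ) ≠ 0 := by
  intro h
  have h1 := Disc.norm_mul_conj_lt_one z w
  rw [← sub_eq_zero.1 h] at h1
  simp at h1

theorem scalarKernel_zero (z w : Disc) : scalarKernel 0 z w = 1 := by simp [scalarKernel]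

theorem scalarKernel_one (z w : Disc) :
    scalarKernel 1 z w = 1 / (1 - (z : ℂ) * conj (w : ℂ)) := by simp [scalarKernel]

theorem scalarKernel_add (l m : ℝ) (z w : Disc) :
    scalarKernel (l + m) z w = scalarKernel l z w * scalarKernel m z w := by
  simp only [scalarKernel, Complex.ofReal_add]
  rw [Complex.cpow_add _ _ (Disc.one_sub_mul_conj_ne_zero z w)]
  simp [mul_comm]

namespace PosKernel

variable {P Q : Disc → Disc → ℂ}

theorem add (hP : PosKernel P) (hQ : PosKernel Q) : PosKernel fun x y => P x y + Q x y := by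
  intro s c
  have := add_nonneg (hP s c) (hQ s c)
  rw [← Complex.add_re, ← Finset.sum_add_distrib] at this
  simpa only [← Finset.sum_add_distrib, ← mul_add] using this

theorem twist (hP : PosKernel P) (g : Disc → ℂ) :
    PosKernel fun x y => g x * conj (g y) * P x y := by
  intro s c
  have := hP s fun x => conj (g x) * c x
  convert this using 4 with x _ y _
  simp
  ring

theorem const_mul (hP : PosKernel P) {a : ℝ} (ha : 0 ≤ a) : PosKernel fun x y => a * P x y := by
  have := hP.twist fun _ => (Real.sqrt a : ℂ)
  convert this using 4 with x y
  rw [Complex.conj_ofReal, ← Complex.ofReal_mul, Real.mul_self_sqrt ha]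

theorem one : PosKernel fun _ _ => 1 := by
  intro s c
  have : ∑ x ∈ s, ∑ y ∈ s, conj (c x) * c y * 1 = ((‖∑ x ∈ s, c x‖ ^ 2 : ℝ) : ℂ) := by
    push_cast
    rw [← Complex.conj_mul', map_sum, Finset.sum_mul_sum]
    simp
  rw [this, Complex.ofReal_re]
  positivity

theorem hasSum {P : ℕ → Disc → Disc → ℂ} (hP : ∀ n, PosKernel (P n))
    (h : ∀ x y, HasSum (fun n => P n x y) (Q x y)) : PosKernel Q := by
  intro s c
  have : HasSum (fun n => ∑ x ∈ s, ∑ y ∈ s, conj (c x) * c y * P n x y)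
      (∑ x ∈ s, ∑ y ∈ s, conj (c x) * c y * Q x y) :=
    hasSum_sum fun x _ => hasSum_sum fun y _ => (h x y).mul_left _
  exact (Complex.hasSum_re this).nonneg fun n => hP n s c

theorem tendsto {P : ℕ → Disc → Disc → ℂ} (hP : ∀ n, PosKernel (P n))
    (h : ∀ x y, Filter.Tendsto (fun n => P n x y) Filter.atTop (nhds (Q x y))) : PosKernel Q := by
  intro s c
  have : Filter.Tendsto (fun n => ∑ x ∈ s, ∑ y ∈ s, conj (c x) * c y * P n x y) Filter.atTop
      (nhds (∑ x ∈ s, ∑ y ∈ s, conj (c x) * c y * Q x y)) :=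
    tendsto_finsetSum _ fun x _ => tendsto_finsetSum _ fun y _ => (h x y).const_mul _
  exact ge_of_tendsto' ((Complex.continuous_re.tendsto _).comp this) fun n => hP n s c

/-- A case of the Schur product theorem: the binomial series has nonnegative coefficients, and its
n-th term twists `P` by `z ^ n`. -/
theorem mul_scalarKernel (hP : PosKernel P) {l : ℝ} (hl : 0 ≤ l) :
    PosKernel fun x y => P x y * scalarKernel l x y := by
  rcases hl.eq_or_lt with rfl | hl
  · simpa [scalarKernel_zero] using hP
  refine hasSum (P := fun n x y => (Ring.choose (l + n - 1) n : ℝ) *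
    ((x : ℂ) ^ n * conj ((y : ℂ) ^ n) * P x y)) (fun n => ?_) fun x y => ?_
  · exact (hP.twist fun x => (x : ℂ) ^ n).const_mul (ringChoose_nonneg hl n)
  · have := (hasSum_discKernel l x y).mul_left (P x y)
    refine this.congr_fun fun n => ?_
    simp
    ring

theorem scalarKernel_sub_one {l : ℝ} (hl : 0 ≤ l) :
    PosKernel fun x y => scalarKernel l x y - 1 := by
  rcases hl.eq_or_lt with rfl | hl
  · intro s c
    simp [scalarKernel_zero]
  refine hasSum (P := fun n x y => (Ring.choose (l + (n + 1 : ℕ) - 1) (n + 1) : ℝ) *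
    ((x : ℂ) ^ (n + 1) * conj ((y : ℂ) ^ (n + 1)) * 1)) (fun n => ?_) fun x y => ?_
  · exact (one.twist fun x => (x : ℂ) ^ (n + 1)).const_mul (ringChoose_nonneg hl (n + 1))
  · have h := hasSum_discKernel l x y
    rw [← hasSum_nat_add_iff' 1] at h
    simp only [Finset.range_one, Finset.sum_singleton, pow_zero, Ring.choose_zero_right] at h
    simpa [scalarKernel] using h

end PosKernel

/-! ### Positivity of Pick kernels -/

/-- Cauchy's formula as a pairing with the Szegő kernel. -/
theorem integral_mul_conj_szego {R : ℝ} (hR : 1 < R) {h : ℂ → ℂ}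
    (hh : DifferentiableOn ℂ h (ball 0 R)) (w : Disc) :
    ∫ θ in (0 : ℝ)..2 * Real.pi,
      conj (1 / (1 - circleMap 0 1 θ * conj (w : ℂ))) * h (circleMap 0 1 θ) =
      2 * Real.pi * h w := by
  have hd : DiffContOnCl ℂ h (ball 0 1) := by
    refine (hh.mono ?_).diffContOnCl
    rw [closure_ball _ one_ne_zero]
    exact closedBall_subset_ball hR
  have h1 := hd.circleIntegral_sub_inv_smul w.2
  rw [circleIntegral] at h1
  have h2 : ∀ θ : ℝ, deriv (circleMap 0 1) θ •
      ((circleMap 0 1 θ - w)⁻¹ • h (circleMap 0 1 θ)) = Complex.I *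
      (conj (1 / (1 - circleMap 0 1 θ * conj (w : ℂ))) * h (circleMap 0 1 θ)) := by
    intro θ
    have hn : ‖circleMap 0 1 θ‖ = 1 := by simp
    have hz : conj (circleMap 0 1 θ) = (circleMap 0 1 θ)⁻¹ := by
      rw [Complex.inv_eq_conj hn]
    have h0 : circleMap 0 1 θ ≠ 0 := by
      intro h
      rw [h] at hn
      simp at hn
    have h3 : circleMap 0 1 θ - w ≠ 0 := by
      intro h
      have := w.norm_lt_one
      rw [← sub_eq_zero.1 h, hn] at this
      exact lt_irrefl _ this
    simp only [deriv_circleMap, smul_eq_mul, map_div₀, map_sub, map_mul, map_one, hz,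
      Complex.conj_conj]
    have h4 : 1 - (circleMap 0 1 θ)⁻¹ * w ≠ 0 := by
      intro h
      apply h3
      field_simp at h
      simpa using h
    field_simp
  simp only [h2] at h1
  rw [intervalIntegral.integral_const_mul, smul_eq_mul] at h1
  have : Complex.I * (∫ θ in (0 : ℝ)..2 * Real.pi,
      conj (1 / (1 - circleMap 0 1 θ * conj (w : ℂ))) * h (circleMap 0 1 θ)) =
      Complex.I * (2 * Real.pi * h w) := by rw [h1]; ring
  exact mul_left_cancel₀ Complex.I_ne_zero this

/-- Let v be the combination of Szegő kernels with coefficients `c y`, and g the one with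
coefficients `c y * conj (f y)`, the image of v under the adjoint of multiplication by `f`. The
quadratic form is C²‖v‖² − ‖g‖² in the Hardy space. Holomorphy past the circle lets every inner
product be a circle integral evaluated by Cauchy's formula. -/
theorem PosKernel.of_differentiableOn_larger {R C : ℝ} (hR : 1 < R) (hC : 0 < C) {f : ℂ → ℂ}
    (hf : DifferentiableOn ℂ f (ball 0 R)) (hb : ∀ z ∈ ball (0 : ℂ) R, ‖f z‖ ≤ C) :
    PosKernel fun x y => ((C : ℂ) ^ 2 - f x * conj (f y)) / (1 - (x : ℂ) * conj (y : ℂ)) := by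
  intro s c
  have hopen : IsOpen {z : ℂ | ∀ x ∈ s, 1 - z * conj (x : ℂ) ≠ 0} := by
    have : {z : ℂ | ∀ x ∈ s, 1 - z * conj (x : ℂ) ≠ 0} =
        ⋂ x ∈ s, {z : ℂ | 1 - z * conj (x : ℂ) ≠ 0} := by ext; simp
    rw [this]
    refine isOpen_biInter_finset fun x _ => isOpen_ne_fun (by fun_prop) (by fun_prop)
  -- The kernels at the finitely many points of `s` have no poles in the closed disc, so by
  -- compactness one radius beyond 1 serves them all.
  obtain ⟨R', hR', hRR', hne⟩ : ∃ R', 1 < R' ∧ R' ≤ R ∧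
      ∀ z ∈ ball (0 : ℂ) R', ∀ x ∈ s, 1 - z * conj (x : ℂ) ≠ 0 := by
    have hsub : closedBall (0 : ℂ) 1 ⊆ {z : ℂ | ∀ x ∈ s, 1 - z * conj (x : ℂ) ≠ 0} := by
      intro z hz x _ h
      have h1 : ‖z * conj (x : ℂ)‖ = 1 := by rw [← sub_eq_zero.1 h]; simp
      rw [norm_mul, RCLike.norm_conj] at h1
      nlinarith [x.norm_lt_one, mem_closedBall_zero_iff.1 hz, norm_nonneg z, norm_nonneg (x : ℂ)]
    obtain ⟨δ, hδ, h⟩ := (isCompact_closedBall (0 : ℂ) 1).exists_thickening_subset_open hopen hsub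
    rw [thickening_closedBall hδ zero_le_one] at h
    refine ⟨min (δ + 1) R, lt_min (by linarith) hR, min_le_right _ _, fun z hz => ?_⟩
    exact h (ball_subset_ball (min_le_left _ _) hz)
  set v : ℂ → ℂ := fun ζ => ∑ y ∈ s, c y * (1 / (1 - ζ * conj (y : ℂ))) with hv
  set g : ℂ → ℂ := fun ζ => ∑ y ∈ s, c y * conj (f y) * (1 / (1 - ζ * conj (y : ℂ))) with hg
  have hker : ∀ y ∈ s, DifferentiableOn ℂ (fun ζ : ℂ => 1 / (1 - ζ * conj (y : ℂ))) (ball 0 R') :=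
    fun y hy => (differentiableOn_const 1).div (by fun_prop) fun z hz => hne z hz y hy
  have hvd : DifferentiableOn ℂ v (ball 0 R') :=
    DifferentiableOn.fun_sum fun y hy => (hker y hy).const_mul _
  have hgd : DifferentiableOn ℂ g (ball 0 R') :=
    DifferentiableOn.fun_sum fun y hy => (hker y hy).const_mul _
  have hfd : DifferentiableOn ℂ f (ball 0 R') := hf.mono (ball_subset_ball hRR')
  have hcirc : ∀ θ : ℝ, circleMap 0 1 θ ∈ ball (0 : ℂ) R' := fun θ => by simpa using hR'
  have hcont : ∀ {h : ℂ → ℂ}, DifferentiableOn ℂ h (ball 0 R') →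
      Continuous fun θ : ℝ => h (circleMap 0 1 θ) := fun {h} hh =>
    hh.continuousOn.comp_continuous (continuous_circleMap 0 1) hcirc
  have pair : ∀ (d : Disc → ℂ) {h : ℂ → ℂ}, DifferentiableOn ℂ h (ball 0 R') →
      ∫ θ in (0 : ℝ)..2 * Real.pi, conj (∑ y ∈ s, d y * (1 / (1 - circleMap 0 1 θ * conj (y : ℂ))))
        * h (circleMap 0 1 θ) = 2 * Real.pi * ∑ y ∈ s, conj (d y) * h y := by
    intro d h hh
    have e : ∀ θ : ℝ, conj (∑ y ∈ s, d y * (1 / (1 - circleMap 0 1 θ * conj (y : ℂ))))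
        * h (circleMap 0 1 θ) = ∑ y ∈ s, conj (d y) *
          (conj (1 / (1 - circleMap 0 1 θ * conj (y : ℂ))) * h (circleMap 0 1 θ)) := by
      intro θ
      rw [map_sum, Finset.sum_mul]
      refine Finset.sum_congr rfl fun y _ => ?_
      rw [map_mul]
      ring
    simp only [e]
    rw [intervalIntegral.integral_finsetSum, Finset.mul_sum]
    · refine Finset.sum_congr rfl fun y _ => ?_
      rw [intervalIntegral.integral_const_mul, integral_mul_conj_szego hR' hh]
      ring
    · intro y hy
      refine Continuous.intervalIntegrable ?_ _ _
      exact continuous_const.mul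
        ((Complex.continuous_conj.comp (hcont (hker y hy))).mul (hcont hh))
  have hvv := pair c hvd
  have hgg := pair (fun y => c y * conj (f y)) hgd
  have hvfg := pair c (hfd.mul hgd)
  set V : ℂ := ∑ y ∈ s, conj (c y) * v y with hV
  set G : ℂ := ∑ y ∈ s, conj (c y * conj (f y)) * g y with hG
  have hG2 : ∑ y ∈ s, conj (c y) * (f * g) y = G := by
    refine Finset.sum_congr rfl fun y _ => ?_
    simp
    ring
  rw [hG2] at hvfg
  -- The real part of the integrand is at least C²(|g| − C|v|)². Since ⟨v, f g⟩ = ‖g‖², the integral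
  -- collapses to a positive multiple of the form.
  have key : ∫ θ in (0 : ℝ)..2 * Real.pi,
      ((C : ℂ) ^ 2 * (conj (g (circleMap 0 1 θ)) * g (circleMap 0 1 θ)) +
        (C : ℂ) ^ 4 * (conj (v (circleMap 0 1 θ)) * v (circleMap 0 1 θ)) -
        2 * (C : ℂ) ^ 2 * (conj (v (circleMap 0 1 θ)) * (f * g) (circleMap 0 1 θ))) =
      (2 * Real.pi * C ^ 2 : ℝ) * ((C : ℂ) ^ 2 * V - G) := by
    have cg := hcont hgd
    have cv := hcont hvd
    have cfg := hcont (hfd.mul hgd)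
    have cg' := Complex.continuous_conj.comp cg
    have cv' := Complex.continuous_conj.comp cv
    have i1 : Continuous fun θ : ℝ =>
        (C : ℂ) ^ 2 * (conj (g (circleMap 0 1 θ)) * g (circleMap 0 1 θ)) :=
      continuous_const.mul (cg'.mul cg)
    have i2 : Continuous fun θ : ℝ =>
        (C : ℂ) ^ 4 * (conj (v (circleMap 0 1 θ)) * v (circleMap 0 1 θ)) :=
      continuous_const.mul (cv'.mul cv)
    have i3 : Continuous fun θ : ℝ =>
        2 * (C : ℂ) ^ 2 * (conj (v (circleMap 0 1 θ)) * (f * g) (circleMap 0 1 θ)) :=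
      continuous_const.mul (cv'.mul cfg)
    have i4 : Continuous fun θ : ℝ =>
        (C : ℂ) ^ 2 * (conj (g (circleMap 0 1 θ)) * g (circleMap 0 1 θ)) +
        (C : ℂ) ^ 4 * (conj (v (circleMap 0 1 θ)) * v (circleMap 0 1 θ)) := i1.add i2
    rw [intervalIntegral.integral_sub (i4.intervalIntegrable _ _)
      (i3.intervalIntegrable _ _), intervalIntegral.integral_add (i1.intervalIntegrable _ _)
      (i2.intervalIntegrable _ _), intervalIntegral.integral_const_mul,
      intervalIntegral.integral_const_mul, intervalIntegral.integral_const_mul]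
    erw [hgg, hvv, hvfg]
    push_cast
    ring
  have hcontF : Continuous fun θ : ℝ =>
      ((C : ℂ) ^ 2 * (conj (g (circleMap 0 1 θ)) * g (circleMap 0 1 θ)) +
        (C : ℂ) ^ 4 * (conj (v (circleMap 0 1 θ)) * v (circleMap 0 1 θ)) -
        2 * (C : ℂ) ^ 2 * (conj (v (circleMap 0 1 θ)) * (f * g) (circleMap 0 1 θ))) := by
    have cg := hcont hgd
    have cv := hcont hvd
    have cfg := hcont (hfd.mul hgd)
    have cg' := Complex.continuous_conj.comp cg
    have cv' := Complex.continuous_conj.comp cv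
    exact ((continuous_const.mul (cg'.mul cg)).add (continuous_const.mul (cv'.mul cv))).sub
      (continuous_const.mul (cv'.mul cfg))
  have hpos : 0 ≤ ((2 * Real.pi * C ^ 2 : ℝ) * ((C : ℂ) ^ 2 * V - G)).re := by
    rw [← key]
    have := Complex.reCLM.intervalIntegral_comp_comm
      (hcontF.intervalIntegrable (μ := MeasureTheory.volume) 0 (2 * Real.pi))
    rw [Complex.reCLM_apply] at this
    rw [← this]
    refine intervalIntegral.integral_nonneg (by positivity) fun θ _ => ?_
    rw [Complex.reCLM_apply]
    set a := g (circleMap 0 1 θ)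
    set b := v (circleMap 0 1 θ)
    have hfa : ‖f (circleMap 0 1 θ)‖ ≤ C := hb _ (ball_subset_ball hRR' (hcirc θ))
    set q := f (circleMap 0 1 θ) with hq
    have e1 : conj a * a = ((‖a‖ ^ 2 : ℝ) : ℂ) := by rw [Complex.conj_mul']; push_cast; rfl
    have e2 : conj b * b = ((‖b‖ ^ 2 : ℝ) : ℂ) := by rw [Complex.conj_mul']; push_cast; rfl
    have e3 : (conj b * (q * a)).re ≤ ‖b‖ * (C * ‖a‖) := by
      refine (Complex.re_le_norm _).trans ?_
      rw [norm_mul, norm_mul, RCLike.norm_conj]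
      gcongr
    have e4 : (((C : ℂ) ^ 2 * (conj a * a) + (C : ℂ) ^ 4 * (conj b * b) -
        2 * (C : ℂ) ^ 2 * (conj b * (f * g) (circleMap 0 1 θ)))).re =
        C ^ 2 * ‖a‖ ^ 2 + C ^ 4 * ‖b‖ ^ 2 - 2 * C ^ 2 * (conj b * (q * a)).re := by
      rw [e1, e2, show (f * g) (circleMap 0 1 θ) = q * a from rfl]
      rw [show (2 * (C : ℂ) ^ 2) = ((2 * C ^ 2 : ℝ) : ℂ) by push_cast; rfl,
        show (C : ℂ) ^ 4 = ((C ^ 4 : ℝ) : ℂ) by push_cast; rfl,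
        show (C : ℂ) ^ 2 = ((C ^ 2 : ℝ) : ℂ) by push_cast; rfl]
      simp only [Complex.sub_re, Complex.add_re, Complex.re_ofReal_mul, Complex.ofReal_re]
    rw [e4]
    have : 0 ≤ C ^ 2 * (‖a‖ - C * ‖b‖) ^ 2 := by positivity
    have : 2 * C ^ 2 * (conj b * (q * a)).re ≤ 2 * C ^ 2 * (‖b‖ * (C * ‖a‖)) := by gcongr
    nlinarith
  rw [Complex.re_ofReal_mul] at hpos
  have h5 := nonneg_of_mul_nonneg_right hpos (by positivity)
  refine h5.trans_eq (congrArg Complex.re ?_)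
  symm
  rw [hV, hG, Finset.mul_sum, ← Finset.sum_sub_distrib]
  refine Finset.sum_congr rfl fun x _ => ?_
  rw [hv, hg]
  simp only [Finset.mul_sum]
  rw [← Finset.sum_sub_distrib]
  refine Finset.sum_congr rfl fun y _ => ?_
  simp only [map_mul, Complex.conj_conj]
  ring

/-- The Pick kernel of a bounded holomorphic function is positive semidefinite. -/
theorem PosKernel.of_bounded {C : ℝ} (hC : 0 < C) {f : ℂ → ℂ}
    (hf : DifferentiableOn ℂ f (ball 0 1)) (hb : ∀ z ∈ ball (0 : ℂ) 1, ‖f z‖ ≤ C) :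
    PosKernel fun x y => ((C : ℂ) ^ 2 - f x * conj (f y)) / (1 - (x : ℂ) * conj (y : ℂ)) := by
  -- The dilations `f (r z)` are holomorphic beyond the closed disc with the same bound, and
  -- positivity survives the limit r → 1.
  set r : ℕ → ℝ := fun n => 1 - 1 / ((n : ℝ) + 2) with hr
  have hr0 : ∀ n, 0 < r n := fun n => by
    have : 1 / ((n : ℝ) + 2) < 1 := by
      rw [div_lt_one (by positivity)]
      have : (0 : ℝ) ≤ n := n.cast_nonneg
      linarith
    simp only [hr]; linarith
  have hr1 : ∀ n, r n < 1 := fun n => by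
    have : 0 < 1 / ((n : ℝ) + 2) := by positivity
    simp only [hr]; linarith
  have hlim : Filter.Tendsto r Filter.atTop (nhds 1) := by
    have h1 : Filter.Tendsto (fun n : ℕ => 1 / ((n : ℝ) + 2)) Filter.atTop (nhds 0) := by
      have := (Filter.tendsto_add_atTop_iff_nat 1).2
        (tendsto_one_div_add_atTop_nhds_zero_nat (𝕜 := ℝ))
      refine this.congr fun n => ?_
      push_cast
      ring
    have h2 := (tendsto_const_nhds (x := (1 : ℝ))).sub h1
    rwa [sub_zero] at h2
  have hmem : ∀ n, ∀ z ∈ ball (0 : ℂ) (r n)⁻¹, (r n : ℂ) * z ∈ ball (0 : ℂ) 1 := by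
    intro n z hz
    rw [mem_ball_zero_iff] at hz ⊢
    rw [norm_mul, Complex.norm_real, Real.norm_of_nonneg (hr0 n).le]
    calc r n * ‖z‖ < r n * (r n)⁻¹ := by gcongr; exact hr0 n
      _ = 1 := mul_inv_cancel₀ (hr0 n).ne'
  have hc : ∀ x : Disc, Filter.Tendsto (fun n => f ((r n : ℂ) * x)) Filter.atTop (nhds (f x)) := by
    intro x
    have h1 : ContinuousAt f x := (hf.differentiableAt (isOpen_ball.mem_nhds x.2)).continuousAt
    refine h1.tendsto.comp ?_
    have := ((Complex.continuous_ofReal.tendsto 1).comp hlim).mul_const (x : ℂ)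
    simpa using this
  refine PosKernel.tendsto (P := fun n x y => ((C : ℂ) ^ 2 - f (r n * x) * conj (f (r n * y))) /
    (1 - (x : ℂ) * conj (y : ℂ))) (fun n => ?_) fun x y => ?_
  · refine PosKernel.of_differentiableOn_larger (f := fun z => f (r n * z))
      ((one_lt_inv₀ (hr0 n)).2 (hr1 n)) hC ?_ ?_
    · exact hf.comp (by fun_prop) (hmem n)
    · exact fun z hz => hb _ (hmem n z hz)
  · refine Filter.Tendsto.div_const ?_ _
    exact tendsto_const_nhds.sub ((hc x).mul ((Complex.continuous_conj.tendsto _).comp (hc y)))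

/-- The kernel splits as the Pick kernel of `f` times the kernel of exponent `l - 1`, plus C² times
(kernel of exponent `m - l`, minus 1) times the kernel of exponent `l`. The conditions `1 ≤ l` and
`l ≤ m` make both summands positive. -/
theorem PosKernel.multiplier {C l m : ℝ} (hC : 0 < C) (hl : 1 ≤ l) (hlm : l ≤ m) {f : ℂ → ℂ}
    (hf : DifferentiableOn ℂ f (ball 0 1)) (hb : ∀ z ∈ ball (0 : ℂ) 1, ‖f z‖ ≤ C) :
    PosKernel fun x y => (C : ℂ) ^ 2 * scalarKernel m x y -
      f x * conj (f y) * scalarKernel l x y := by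
  have h1 := (PosKernel.of_bounded hC hf hb).mul_scalarKernel (sub_nonneg.2 hl)
  have h2 := ((PosKernel.scalarKernel_sub_one (sub_nonneg.2 hlm)).mul_scalarKernel
    (zero_le_one.trans hl)).const_mul (sq_nonneg C)
  convert h1.add h2 using 3 with x y
  have e1 : scalarKernel l x y = scalarKernel (l - 1) x y * (1 / (1 - (x : ℂ) * conj (y : ℂ))) := by
    rw [← scalarKernel_one, ← scalarKernel_add, sub_add_cancel]
  have e2 : scalarKernel m x y = scalarKernel (m - l) x y * scalarKernel l x y := by
    rw [← scalarKernel_add, sub_add_cancel]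
  rw [e2, e1]
  push_cast
  ring

/-! ### The weighted spaces: multipliers, monomials, holomorphy, commutators -/

namespace DiscSpace

variable {l m : ℝ}

/-- The reproducing kernel vector at `w`. -/
noncomputable def kernelVec (hl : 0 < l) (w : Disc) : DiscSpace l hl :=
  RKHS.kerFun (DiscSpace l hl) w (1 : ℂ)

theorem kernelVec_apply (hl : 0 < l) (w z : Disc) : kernelVec hl w z = scalarKernel l z w := by
  rw [kernelVec, RKHS.kerFun_apply, kernel_eq]
  simp [discKernel, scalarKernel]

theorem kernelVec_zero_apply (hl : 0 < l) (z : Disc) :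
    kernelVec hl ⟨0, by simp⟩ z = 1 := by
  rw [kernelVec_apply]
  simp [scalarKernel]

theorem inner_kernelVec (hl : 0 < l) (w : Disc) (g : DiscSpace l hl) :
    ⟪kernelVec hl w, g⟫_ℂ = g w := by
  rw [kernelVec, RKHS.kerFun_inner]
  simp

theorem eq_zero_of_inner_kernelVec {hl : 0 < l} {g : DiscSpace l hl}
    (h : ∀ w, ⟪kernelVec hl w, g⟫_ℂ = 0) : g = 0 := by
  refine RKHS.ext fun z => ?_
  rw [← inner_kernelVec, h]
  simp

theorem scalarKernel_self (l : ℝ) (w : Disc) :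
    scalarKernel l w w = (((1 - ‖(w : ℂ)‖ ^ 2) ^ (-l) : ℝ) : ℂ) := by
  have h : 0 ≤ 1 - ‖(w : ℂ)‖ ^ 2 := by nlinarith [w.norm_lt_one, norm_nonneg (w : ℂ)]
  rw [scalarKernel, Complex.mul_conj', ← Complex.ofReal_one, ← Complex.ofReal_pow,
    ← Complex.ofReal_sub, ← Complex.ofReal_cpow h, Real.rpow_neg h]
  push_cast
  rw [one_div]

theorem norm_kernelVec_sq (hl : 0 < l) (w : Disc) :
    ‖kernelVec hl w‖ ^ 2 = (1 - ‖(w : ℂ)‖ ^ 2) ^ (-l) := by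
  have h := inner_self_eq_norm_sq_to_K (𝕜 := ℂ) (kernelVec hl w)
  rw [inner_kernelVec, kernelVec_apply, scalarKernel_self] at h
  refine Complex.ofReal_injective ?_
  rw [Complex.ofReal_pow]
  exact h.symm

theorem norm_linearCombination_sq (hl : 0 < l) (p : Disc → Disc) (a : Disc → ℂ)
    (c : Disc →₀ ℂ) :
    ‖Finsupp.linearCombination ℂ (fun y => a y • kernelVec hl (p y)) c‖ ^ 2 =
      (∑ x ∈ c.support, ∑ y ∈ c.support,
        conj (c x) * c y * (conj (a x) * a y * scalarKernel l (p x) (p y))).re := by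
  have h := inner_self_eq_norm_sq_to_K (𝕜 := ℂ)
    (Finsupp.linearCombination ℂ (fun y => a y • kernelVec hl (p y)) c)
  rw [Finsupp.linearCombination_apply, Finsupp.sum, sum_inner] at h
  simp only [inner_sum, inner_smul_left, inner_smul_right, inner_kernelVec, kernelVec_apply] at h
  have h2 := congrArg Complex.re h
  rw [Finsupp.linearCombination_apply, Finsupp.sum]
  convert h2.symm using 2
  · norm_cast
  · refine Finset.sum_congr rfl fun x _ => Finset.sum_congr rfl fun y _ => ?_
    ring

/-- A positivity criterion for the boundedness of a weighted composition operator. -/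
theorem exists_weightedComp (hl : 0 < l) (hm : 0 < m) {M : ℝ} (hM : 0 ≤ M) (p : Disc → Disc)
    (a : Disc → ℂ) (h : PosKernel fun x y => (M : ℂ) ^ 2 * scalarKernel m x y -
      a x * conj (a y) * scalarKernel l (p x) (p y)) :
    ∃ L : DiscSpace l hl →L[ℂ] DiscSpace m hm, ‖L‖ ≤ M ∧ ∀ g z, L g z = a z * g (p z) := by
  -- The adjoint of the desired operator must send the kernel vector at y to `conj (a y)` times the
  -- one at `p y`. The positivity hypothesis says precisely that this rule has norm at most `M` on
  -- finite combinations, which are dense.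
  set e := Finsupp.linearCombination ℂ (fun y => (1 : ℂ) • kernelVec hm (id y)) with he
  set f := Finsupp.linearCombination ℂ (fun y => conj (a y) • kernelVec hl (p y)) with hf
  have hnorm : ∀ c, ‖f c‖ ≤ M * ‖e c‖ := by
    intro c
    refine (sq_le_sq₀ (norm_nonneg _) (by positivity)).1 ?_
    rw [mul_pow, he, hf, norm_linearCombination_sq, norm_linearCombination_sq]
    have h1 := h c.support c
    rw [← sub_nonneg, ← Complex.re_ofReal_mul, ← Complex.sub_re, Finset.mul_sum,
      ← Finset.sum_sub_distrib]
    refine h1.trans_eq (congrArg Complex.re (Finset.sum_congr rfl fun x _ => ?_))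
    push_cast
    rw [Finset.mul_sum, ← Finset.sum_sub_distrib]
    refine Finset.sum_congr rfl fun y _ => ?_
    simp
    ring
  have hdense : DenseRange e := by
    rw [DenseRange, ← LinearMap.coe_range, Submodule.dense_iff_topologicalClosure_eq_top,
      ← Submodule.orthogonal_eq_bot_iff, Submodule.eq_bot_iff]
    intro g hg
    refine eq_zero_of_inner_kernelVec fun w => ?_
    refine (Submodule.mem_orthogonal _ _).1 hg _
      (Submodule.le_topologicalClosure _ ⟨Finsupp.single w 1, ?_⟩)
    simp [he]
  refine ⟨ContinuousLinearMap.adjoint (f.extendOfNorm e), ?_, fun g z => ?_⟩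
  · rw [LinearIsometryEquiv.norm_map]
    exact LinearMap.opNorm_extendOfNorm_le hdense hM hnorm
  · have h1 : e (Finsupp.single z 1) = kernelVec hm z := by simp [he]
    have h2 : f (Finsupp.single z 1) = conj (a z) • kernelVec hl (p z) := by simp [hf]
    rw [← inner_kernelVec, ContinuousLinearMap.adjoint_inner_right, ← h1,
      LinearMap.extendOfNorm_eq hdense ⟨M, hnorm⟩, h2, inner_smul_left, inner_kernelVec]
    simp

theorem exists_multiplier (hl : 1 ≤ l) (hlm : l ≤ m) (hl0 : 0 < l) (hm0 : 0 < m) {C : ℝ}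
    (hC : 0 < C) {f : ℂ → ℂ} (hf : DifferentiableOn ℂ f (ball 0 1))
    (hb : ∀ z ∈ ball (0 : ℂ) 1, ‖f z‖ ≤ C) :
    ∃ L : DiscSpace l hl0 →L[ℂ] DiscSpace m hm0, ‖L‖ ≤ C ∧ ∀ g (z : Disc), L g z = f z * g z :=
  exists_weightedComp hl0 hm0 hC.le id (fun z => f z) (PosKernel.multiplier hC hl hlm hf hb)

theorem isMultiplier (hl : 1 ≤ l) (hlm : l ≤ m) (hl0 : 0 < l) (hm0 : 0 < m)
    {f : ℂ → ℂ} (hf : DifferentiableOn ℂ f (ball 0 1))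
    (hb : ∃ C : ℝ, ∀ z ∈ ball (0 : ℂ) 1, ‖f z‖ ≤ C) :
    IsMultiplier (DiscSpace l hl0) (DiscSpace m hm0) f := by
  obtain ⟨C, hC⟩ := hb
  obtain ⟨L, -, h⟩ := exists_multiplier hl hlm hl0 hm0 (C := |C| + 1) (by positivity) hf
    fun z hz => (hC z hz).trans ((le_abs_self C).trans (by linarith))
  exact ⟨L, h⟩

/-- Multiplication by `z ^ n` is contractive, and the kernel vector at 0 is the constant 1. The
bound being uniform in `n` gives absolute convergence of the expansions below. -/
theorem exists_monomial (hl : 1 ≤ l) (hl0 : 0 < l) (n : ℕ) :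
    ∃ g : DiscSpace l hl0, ‖g‖ ≤ ‖kernelVec hl0 ⟨0, by simp⟩‖ ∧ ∀ z : Disc, g z = (z : ℂ) ^ n := by
  obtain ⟨L, hL, h⟩ := exists_multiplier hl le_rfl hl0 hl0 (C := 1) one_pos
    (f := fun z => z ^ n) (by fun_prop) fun z hz => by
      rw [norm_pow]
      exact pow_le_one₀ (norm_nonneg _) (mem_ball_zero_iff.1 hz).le
  refine ⟨L (kernelVec hl0 ⟨0, by simp⟩), ?_, fun z => ?_⟩
  · exact (L.le_of_opNorm_le hL _).trans_eq (one_mul _)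
  · rw [h, kernelVec_zero_apply, mul_one]

/-- The monomial `z ^ n` as an element of the space. -/
noncomputable def monomial (hl : 1 ≤ l) (hl0 : 0 < l) (n : ℕ) : DiscSpace l hl0 :=
  (exists_monomial hl hl0 n).choose

theorem monomial_apply (hl : 1 ≤ l) (hl0 : 0 < l) (n : ℕ) (z : Disc) :
    monomial hl hl0 n z = (z : ℂ) ^ n := (exists_monomial hl hl0 n).choose_spec.2 z

theorem norm_monomial_le (hl : 1 ≤ l) (hl0 : 0 < l) (n : ℕ) :
    ‖monomial hl hl0 n‖ ≤ ‖kernelVec hl0 ⟨0, by simp⟩‖ := (exists_monomial hl hl0 n).choose_spec.1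

theorem summable_choose (l : ℝ) {r : ℝ} (h0 : 0 ≤ r) (h1 : r < 1) :
    Summable fun n : ℕ => Ring.choose (l + n - 1) n * r ^ n := by
  -- At z = w = √r the binomial series of the kernel becomes the series in `r ^ n`.
  have hs : Real.sqrt r < 1 := by
    rw [Real.sqrt_lt' one_pos]
    simpa using h1
  have hmem : ((Real.sqrt r : ℝ) : ℂ) ∈ ball (0 : ℂ) 1 := by
    rw [mem_ball_zero_iff, Complex.norm_real, Real.norm_of_nonneg (Real.sqrt_nonneg _)]
    exact hs
  have h := (hasSum_discKernel l ⟨_, hmem⟩ ⟨_, hmem⟩).summable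
  rw [← Complex.summable_ofReal]
  refine h.congr fun n => ?_
  rw [Complex.conj_ofReal, ← mul_pow, ← Complex.ofReal_mul, Real.mul_self_sqrt h0]
  push_cast
  rfl

/-- Lifts the binomial series to convergence in norm. Pairing with it gives the power series of
every element, hence holomorphy and the density of polynomials. -/
theorem hasSum_kernelVec (hl : 1 ≤ l) (hl0 : 0 < l) (w : Disc) :
    HasSum (fun n : ℕ => (((Ring.choose (l + n - 1) n : ℝ) : ℂ) * conj (w : ℂ) ^ n) •
      monomial hl hl0 n) (kernelVec hl0 w) := by
  have hs : Summable fun n : ℕ => (((Ring.choose (l + n - 1) n : ℝ) : ℂ) * conj (w : ℂ) ^ n) •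
      monomial hl hl0 n := by
    refine Summable.of_norm_bounded ((summable_choose l (norm_nonneg (w : ℂ)) w.norm_lt_one).mul_right
      ‖kernelVec hl0 ⟨0, by simp⟩‖) fun n => ?_
    rw [norm_smul, norm_mul, norm_pow, RCLike.norm_conj, Complex.norm_real,
      Real.norm_of_nonneg (ringChoose_nonneg hl0 n)]
    gcongr
    · exact mul_nonneg (ringChoose_nonneg hl0 n) (by positivity)
    · exact norm_monomial_le hl hl0 n
  convert hs.hasSum
  refine RKHS.ext fun z => ?_
  have h1 := (innerSL ℂ (kernelVec hl0 z)).hasSum hs.hasSum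
  simp only [innerSL_apply_apply, inner_smul_right, inner_kernelVec, monomial_apply] at h1
  rw [kernelVec_apply]
  refine HasSum.unique ?_ h1
  refine (hasSum_discKernel l z w).congr_fun fun n => ?_
  ring

theorem hasSum_apply (hl : 1 ≤ l) (hl0 : 0 < l) (g : DiscSpace l hl0) (w : Disc) :
    HasSum (fun n : ℕ => ((Ring.choose (l + n - 1) n : ℝ) : ℂ) * (w : ℂ) ^ n *
      ⟪monomial hl hl0 n, g⟫_ℂ) (g w) := by
  have h := (innerSL ℂ g).hasSum (hasSum_kernelVec hl hl0 w)
  rw [← Complex.hasSum_conj'] at h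
  simp only [innerSL_apply_apply, inner_smul_right, map_mul, map_pow, Complex.conj_ofReal,
    Complex.conj_conj, inner_conj_symm, inner_kernelVec] at h
  exact h

/-- The elements of the space are holomorphic functions. -/
theorem exists_differentiableOn (hl : 1 ≤ l) (hl0 : 0 < l) (g : DiscSpace l hl0) :
    ∃ F : ℂ → ℂ, DifferentiableOn ℂ F (ball 0 1) ∧ ∀ z : Disc, g z = F z := by
  refine ⟨fun z => ∑' n : ℕ, ((Ring.choose (l + n - 1) n : ℝ) : ℂ) * z ^ n *
    ⟪monomial hl hl0 n, g⟫_ℂ, fun z hz => ?_, fun z => (hasSum_apply hl hl0 g z).tsum_eq.symm⟩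
  obtain ⟨r, hzr, hr⟩ := exists_between (mem_ball_zero_iff.1 hz)
  have hr0 : 0 ≤ r := (norm_nonneg z).trans hzr.le
  refine DifferentiableAt.differentiableWithinAt ?_
  refine (Complex.differentiableOn_tsum_of_summable_norm
    ((summable_choose l hr0 hr).mul_right (‖kernelVec hl0 ⟨0, by simp⟩‖ * ‖g‖))
    (fun n => by fun_prop) isOpen_ball fun n w hw => ?_).differentiableAt
    (isOpen_ball.mem_nhds (mem_ball_zero_iff.2 hzr))
  rw [norm_mul, norm_mul, norm_pow, Complex.norm_real, Real.norm_of_nonneg (ringChoose_nonneg hl0 n)]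
  have h0 := ringChoose_nonneg hl0 n
  have h1 : ‖w‖ ≤ r := (mem_ball_zero_iff.1 hw).le
  gcongr
  exact (norm_inner_le_norm _ _).trans (by gcongr; exact norm_monomial_le hl hl0 n)

theorem clm_eq_zero_of_monomial (hl : 1 ≤ l) (hl0 : 0 < l) (f : DiscSpace l hl0 →L[ℂ] ℂ)
    (h : ∀ n, f (monomial hl hl0 n) = 0) : f = 0 := by
  obtain ⟨v, rfl⟩ := (InnerProductSpace.toDual ℂ (DiscSpace l hl0)).surjective f
  suffices v = 0 by simp [this]
  refine RKHS.ext fun z => (hasSum_apply hl hl0 v z).unique ?_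
  have h1 : ∀ n, ⟪monomial hl hl0 n, v⟫_ℂ = 0 := fun n => by
    rw [← inner_conj_symm, ← InnerProductSpace.toDual_apply_apply, h n, map_zero]
  simp [h1, hasSum_zero]

/-- A holomorphic function on the disc vanishes if its product with a nonzero one does. -/
theorem _root_.eq_zero_of_mul_eq_zero_on_disc {F G : ℂ → ℂ} (hF : DifferentiableOn ℂ F (ball 0 1))
    (hG : DifferentiableOn ℂ G (ball 0 1)) (hG0 : ∃ z : Disc, G z ≠ 0)
    (h : ∀ z : Disc, F z * G z = 0) (z : Disc) : F z = 0 := by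
  obtain ⟨w, hw⟩ := hG0
  have hc : ContinuousAt G w := (hG.differentiableAt (isOpen_ball.mem_nhds w.2)).continuousAt
  have hev : F =ᶠ[nhds (w : ℂ)] 0 := by
    filter_upwards [hc.eventually_ne hw, isOpen_ball.mem_nhds w.2] with x hx hxb
    exact (mul_eq_zero.1 (h ⟨x, hxb⟩)).resolve_right hx
  exact (hF.analyticOnNhd isOpen_ball).eqOn_zero_of_preconnected_of_eventuallyEq_zero
    (convex_ball _ _).isPreconnected w.2 hev z.2

/-- The functional `g ↦ g z`. -/
noncomputable def evalCLM (hl : 0 < l) (z : Disc) : DiscSpace l hl →L[ℂ] ℂ :=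
  innerSL ℂ (kernelVec hl z)

theorem evalCLM_apply (hl : 0 < l) (z : Disc) (g : DiscSpace l hl) : evalCLM hl z g = g z := by
  rw [evalCLM, innerSL_apply_apply, inner_kernelVec]

/-- An operator that commutes with multiplication by `z` is a multiplication operator. -/
theorem apply_eq_mul_of_commute (hl : 1 ≤ l) (hl0 : 0 < l) (hm0 : 0 < m)
    (Y : DiscSpace l hl0 →L[ℂ] DiscSpace m hm0)
    (hY : ∀ g g' : DiscSpace l hl0, (∀ z : Disc, g' z = z * g z) → ∀ z : Disc, Y g' z = z * Y g z)
    (g : DiscSpace l hl0) (z : Disc) : Y g z = Y (monomial hl hl0 0) z * g z := by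
  have h1 : ∀ n, Y (monomial hl hl0 n) z = (z : ℂ) ^ n * Y (monomial hl hl0 0) z := by
    intro n
    induction n with
    | zero => simp
    | succ n ih =>
      rw [hY (monomial hl hl0 n) _ (fun z => by simp only [monomial_apply]; ring), ih]
      ring
  -- The functionals g ↦ (Yg)(z) and g ↦ (Y1)(z) g(z) agree on monomials, hence everywhere.
  have h2 := clm_eq_zero_of_monomial hl hl0
    ((evalCLM hm0 z).comp Y - Y (monomial hl hl0 0) z • evalCLM hl0 z) fun n => by
      rw [sub_apply, ContinuousLinearMap.comp_apply, evalCLM_apply,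
        smul_apply, evalCLM_apply, h1, monomial_apply, smul_eq_mul, mul_comm,
        sub_self]
  have h3 := DFunLike.congr_fun h2 g
  simpa [evalCLM_apply, sub_eq_zero] using h3

/-- Pairing `Y k` with `k`, for `k` the kernel vector at `z`, gives `b z * ‖k‖ ^ 2`; Cauchy–Schwarz
bounds it. -/
theorem norm_multiplier_le (hl0 : 0 < l) (Y : DiscSpace l hl0 →L[ℂ] DiscSpace l hl0)
    {b : Disc → ℂ} (hY : ∀ g z, Y g z = b z * g z) (z : Disc) : ‖b z‖ ≤ ‖Y‖ := by
  have h1 : ⟪kernelVec hl0 z, Y (kernelVec hl0 z)⟫_ℂ =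
      b z * ⟪kernelVec hl0 z, kernelVec hl0 z⟫_ℂ := by
    rw [inner_kernelVec, inner_kernelVec, hY]
  have h2 : ‖⟪kernelVec hl0 z, Y (kernelVec hl0 z)⟫_ℂ‖ ≤
      ‖Y‖ * (‖kernelVec hl0 z‖ * ‖kernelVec hl0 z‖) := by
    refine (norm_inner_le_norm _ _).trans ?_
    have := Y.le_opNorm (kernelVec hl0 z)
    nlinarith [norm_nonneg (kernelVec hl0 z)]
  rw [h1, norm_mul, inner_self_eq_norm_sq_to_K, norm_pow, RCLike.norm_ofReal, abs_norm,
    ← sq] at h2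
  refine le_of_mul_le_mul_right h2 ?_
  rw [norm_kernelVec_sq]
  have : 0 < 1 - ‖(z : ℂ)‖ ^ 2 := by nlinarith [norm_nonneg (z : ℂ), z.norm_lt_one]
  positivity

/-- If `m < l + 2`, the commutator of an operator `DiscSpace l → DiscSpace m` with multiplication
by `z` is never a nonzero multiplication operator. -/
theorem eq_zero_of_commutator (hl : 1 ≤ l) (hm : 1 ≤ m) (hlm : m < l + 2) (hl0 : 0 < l)
    (hm0 : 0 < m) (Y : DiscSpace l hl0 →L[ℂ] DiscSpace m hm0) (d : Disc → ℂ)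
    (hY : ∀ g g' : DiscSpace l hl0, (∀ z : Disc, g' z = z * g z) →
      ∀ z : Disc, Y g' z = z * Y g z + d z * g z) (z : Disc) : d z = 0 := by
  -- Test `Y` on the kernel vector at `w` times the Blaschke factor (z − w)/(1 − z w̄), whose
  -- multiplication operator is contractive. Because the factor contains z − w, the value at `w` is
  -- `d w` times (1 − |w|²)^(−1−l), while the norms of the two kernel vectors allow at most ‖Y‖(1 −
  -- |w|²)^(−(l+m)/2).
  have bound : ∀ w : Disc, ‖d w‖ ≤ ‖Y‖ * (1 - ‖(w : ℂ)‖ ^ 2) ^ ((l + 2 - m) / 2) := by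
    intro w
    have hw : ‖(w : ℂ)‖ < 1 := w.norm_lt_one
    have hne : ∀ z : Disc, 1 - (z : ℂ) * conj (w : ℂ) ≠ 0 := fun z =>
      Disc.one_sub_mul_conj_ne_zero z w
    have ht : 0 < 1 - ‖(w : ℂ)‖ ^ 2 := by nlinarith [norm_nonneg (w : ℂ)]
    have hd1 : DifferentiableOn ℂ (fun z : ℂ => 1 / (1 - z * conj (w : ℂ))) (ball 0 1) :=
      (differentiableOn_const 1).div (by fun_prop) fun z hz => hne ⟨z, hz⟩
    have hlow : ∀ z ∈ ball (0 : ℂ) 1, 1 - ‖(w : ℂ)‖ ≤ ‖1 - z * conj (w : ℂ)‖ := by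
      intro z hz
      have h1 := norm_sub_norm_le (1 : ℂ) (z * conj (w : ℂ))
      rw [norm_mul, RCLike.norm_conj, norm_one] at h1
      nlinarith [mem_ball_zero_iff.1 hz, norm_nonneg (w : ℂ), norm_nonneg z]
    obtain ⟨L₁, -, hL₁⟩ := exists_multiplier hl le_rfl hl0 hl0 (C := 1 / (1 - ‖(w : ℂ)‖))
      (by have := sub_pos.2 hw; positivity) hd1 fun z hz => by
        rw [norm_div, norm_one]
        exact one_div_le_one_div_of_le (sub_pos.2 hw) (hlow z hz)
    obtain ⟨L₂, -, hL₂⟩ := exists_multiplier hl le_rfl hl0 hl0 (C := 1) one_pos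
      (f := fun z => z) (by fun_prop) fun z hz => (mem_ball_zero_iff.1 hz).le
    obtain ⟨L₃, hL₃', hL₃⟩ := exists_multiplier hl le_rfl hl0 hl0 (C := 1) one_pos
      (f := fun z => (z - w) * (1 / (1 - z * conj (w : ℂ))))
      ((differentiableOn_id.sub_const _).mul hd1) fun z hz => by
        rw [mul_one_div, norm_div]
        refine div_le_one_of_le₀ ?_ (norm_nonneg _)
        refine (sq_le_sq₀ (norm_nonneg _) (norm_nonneg _)).1 ?_
        have hz' := mem_ball_zero_iff.1 hz
        have e : ‖1 - z * conj (w : ℂ)‖ ^ 2 - ‖z - w‖ ^ 2 =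
            (1 - ‖z‖ ^ 2) * (1 - ‖(w : ℂ)‖ ^ 2) := by
          simp only [← Complex.normSq_eq_norm_sq, Complex.normSq_apply, Complex.sub_re,
            Complex.sub_im, Complex.mul_re, Complex.mul_im, Complex.conj_re, Complex.conj_im,
            Complex.one_re, Complex.one_im]
          ring
        have : 0 ≤ 1 - ‖z‖ ^ 2 := by nlinarith [norm_nonneg z]
        nlinarith [mul_nonneg this ht.le]
    set k := kernelVec hl0 w with hk
    have hrel : L₃ k = L₂ (L₁ k) - (w : ℂ) • L₁ k := by
      refine RKHS.ext fun z => ?_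
      rw [RKHS.coe_sub, RKHS.coe_smul, Pi.sub_apply, Pi.smul_apply, hL₂, hL₁, hL₃, smul_eq_mul]
      ring
    have hval : Y (L₃ k) w = d w * (scalarKernel 1 w w * scalarKernel l w w) := by
      rw [hrel, map_sub, map_smul, RKHS.coe_sub, RKHS.coe_smul, Pi.sub_apply, Pi.smul_apply,
        hY _ _ (fun z => hL₂ (L₁ k) z), hL₁, hk, kernelVec_apply, smul_eq_mul, scalarKernel_one]
      ring
    have h1 : ‖Y (L₃ k) w‖ ≤ ‖kernelVec hm0 w‖ * (‖Y‖ * ‖k‖) := by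
      rw [← inner_kernelVec]
      refine (norm_inner_le_norm _ _).trans ?_
      gcongr
      refine (Y.le_opNorm _).trans ?_
      gcongr
      exact (L₃.le_of_opNorm_le hL₃' _).trans_eq (one_mul _)
    have hnorm : ∀ {l : ℝ} (hl0 : 0 < l), ‖kernelVec hl0 w‖ = (1 - ‖(w : ℂ)‖ ^ 2) ^ (-l / 2) := by
      intro l hl0
      rw [← sq_eq_sq₀ (norm_nonneg _) (by positivity), norm_kernelVec_sq,
        sq ((1 - ‖(w : ℂ)‖ ^ 2) ^ (-l / 2)), ← Real.rpow_add ht, add_halves]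
    rw [hval, norm_mul, ← scalarKernel_add, scalarKernel_self, Complex.norm_real,
      Real.norm_of_nonneg (by positivity), hk, hnorm, hnorm] at h1
    have h2 : (1 - ‖(w : ℂ)‖ ^ 2) ^ (-m / 2) * (‖Y‖ * (1 - ‖(w : ℂ)‖ ^ 2) ^ (-l / 2)) =
        ‖Y‖ * (1 - ‖(w : ℂ)‖ ^ 2) ^ ((l + 2 - m) / 2) * (1 - ‖(w : ℂ)‖ ^ 2) ^ (-(1 + l)) := by
      rw [mul_assoc, ← Real.rpow_add ht, mul_left_comm, ← Real.rpow_add ht]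
      congr 2
      ring
    rw [h2] at h1
    exact le_of_mul_le_mul_right h1 (by positivity)
  -- As d = Y(z) − z Y(1), it is holomorphic. The bound tends to zero at the circle because l + 2 −
  -- m > 0, so the maximum principle gives d = 0.
  obtain ⟨F₀, hF₀, hF₀'⟩ := exists_differentiableOn hm hm0 (Y (monomial hl hl0 0))
  obtain ⟨F₁, hF₁, hF₁'⟩ := exists_differentiableOn hm hm0 (Y (monomial hl hl0 1))
  set D : ℂ → ℂ := fun z => F₁ z - z * F₀ z with hD
  have hDd : DifferentiableOn ℂ D (ball 0 1) := hF₁.sub (differentiableOn_id.mul hF₀)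
  have hDz : ∀ z : Disc, d z = D z := by
    intro z
    have := hY (monomial hl hl0 0) (monomial hl hl0 1) (fun z => by simp [monomial_apply]) z
    rw [monomial_apply, pow_zero, mul_one] at this
    simp only [hD]
    rw [← hF₀', ← hF₁', this]
    ring
  set e := (l + 2 - m) / 2 with he
  have he0 : 0 < e := by rw [he]; linarith
  have hle : ∀ r : ℝ, ‖(z : ℂ)‖ < r → r < 1 → ‖D z‖ ≤ ‖Y‖ * (1 - r ^ 2) ^ e := by
    intro r hzr hr
    have hr0 : 0 < r := (norm_nonneg _).trans_lt hzr
    refine Complex.norm_le_of_forall_mem_frontier_norm_le (U := ball 0 r) isBounded_ball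
      ((hDd.mono ?_).diffContOnCl) (fun w hw => ?_) (subset_closure (mem_ball_zero_iff.2 hzr))
    · rw [closure_ball _ hr0.ne']
      exact closedBall_subset_ball hr
    · rw [frontier_ball _ hr0.ne', mem_sphere_zero_iff_norm] at hw
      have := bound ⟨w, mem_ball_zero_iff.2 (hw.trans_lt hr)⟩
      rw [hDz] at this
      simpa only [hw] using this
  have hlim : Filter.Tendsto (fun r : ℝ => ‖Y‖ * (1 - r ^ 2) ^ e) (nhdsWithin 1 (Set.Iio 1))
      (nhds 0) := by
    have hc : Continuous fun r : ℝ => ‖Y‖ * (1 - r ^ 2) ^ e :=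
      continuous_const.mul ((by fun_prop : Continuous fun r : ℝ => 1 - r ^ 2).rpow_const
        fun _ => Or.inr he0.le)
    have := hc.tendsto 1
    simp only [one_pow, sub_self, Real.zero_rpow he0.ne', mul_zero] at this
    exact this.mono_left nhdsWithin_le_nhds
  rw [hDz, ← norm_le_zero_iff]
  refine ge_of_tendsto hlim ?_
  filter_upwards [Ioo_mem_nhdsLT z.norm_lt_one] with r hr
  exact hle r hr.1 hr.2

end DiscSpace

/-! ### The ring of bounded holomorphic functions -/

/-- The ring of bounded holomorphic functions on the disc. -/
def boundedHolo : Subring (Disc → ℂ) where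
  carrier := {f | ∃ F : ℂ → ℂ, DifferentiableOn ℂ F (ball 0 1) ∧
    (∃ C : ℝ, ∀ z ∈ ball (0 : ℂ) 1, ‖F z‖ ≤ C) ∧ ∀ z : Disc, f z = F z}
  zero_mem' := ⟨0, differentiableOn_const 0, ⟨0, by simp⟩, fun _ => rfl⟩
  one_mem' := ⟨1, differentiableOn_const 1, ⟨1, by simp⟩, fun _ => rfl⟩
  add_mem' := by
    rintro f g ⟨F, hF, ⟨C, hC⟩, hf⟩ ⟨G, hG, ⟨D, hD⟩, hg⟩
    exact ⟨F + G, hF.add hG, ⟨C + D, fun z hz => norm_add_le_of_le (hC z hz) (hD z hz)⟩,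
      fun z => by simp [hf, hg]⟩
  mul_mem' := by
    rintro f g ⟨F, hF, ⟨C, hC⟩, hf⟩ ⟨G, hG, ⟨D, hD⟩, hg⟩
    exact ⟨F * G, hF.mul hG, ⟨C * D, fun z hz => norm_mul_le_of_le (hC z hz) (hD z hz)⟩,
      fun z => by simp [hf, hg]⟩
  neg_mem' := by
    rintro f ⟨F, hF, ⟨C, hC⟩, hf⟩
    exact ⟨-F, hF.neg, ⟨C, fun z hz => by simpa using hC z hz⟩, fun z => by simp [hf]⟩

namespace boundedHolo

/-- A bounded holomorphic function on the disc, from a function on the plane. -/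
def ofFun (F : ℂ → ℂ) (hF : DifferentiableOn ℂ F (ball 0 1))
    (hb : ∃ C : ℝ, ∀ z ∈ ball (0 : ℂ) 1, ‖F z‖ ≤ C) : boundedHolo :=
  ⟨fun z => F z, F, hF, hb, fun _ => rfl⟩

theorem ofFun_apply {F : ℂ → ℂ} (hF : DifferentiableOn ℂ F (ball 0 1))
    (hb : ∃ C : ℝ, ∀ z ∈ ball (0 : ℂ) 1, ‖F z‖ ≤ C) (z : Disc) : (ofFun F hF hb).1 z = F z := rfl

/-- An extension to the plane. -/
noncomputable def extend (f : boundedHolo) : ℂ → ℂ := f.2.choose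

theorem differentiableOn_extend (f : boundedHolo) : DifferentiableOn ℂ (extend f) (ball 0 1) :=
  f.2.choose_spec.1

theorem bounded_extend (f : boundedHolo) : ∃ C : ℝ, ∀ z ∈ ball (0 : ℂ) 1, ‖extend f z‖ ≤ C :=
  f.2.choose_spec.2.1

theorem extend_apply (f : boundedHolo) (z : Disc) : extend f z = f.1 z :=
  (f.2.choose_spec.2.2 z).symm

/-- A function bounded away from zero is invertible. -/
theorem isUnit {f : boundedHolo} {ε : ℝ} (hε : 0 < ε) (h : ∀ z, ε ≤ ‖f.1 z‖) : IsUnit f := by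
  have h0 : ∀ z ∈ ball (0 : ℂ) 1, ε ≤ ‖extend f z‖ := fun z hz => by
    rw [extend_apply f ⟨z, hz⟩]; exact h _
  refine IsUnit.of_mul_eq_one (ofFun (fun z => (extend f z)⁻¹)
    ((differentiableOn_extend f).inv fun z hz hz0 => ?_) ⟨ε⁻¹, fun z hz => ?_⟩) ?_
  · have := h0 z hz
    rw [hz0, norm_zero] at this
    linarith
  · rw [norm_inv]
    exact inv_anti₀ hε (h0 z hz)
  · ext z
    have : f.1 z ≠ 0 := fun h1 => by
      have := h z
      rw [h1, norm_zero] at this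
      linarith
    simp [ofFun, extend_apply, this]

/-- The constants. -/
def const : ℂ →+* boundedHolo where
  toFun c := ofFun (fun _ => c) (differentiableOn_const c) ⟨‖c‖, fun _ _ => le_rfl⟩
  map_one' := rfl
  map_mul' _ _ := rfl
  map_zero' := rfl
  map_add' _ _ := rfl

theorem const_apply (c : ℂ) (z : Disc) : (const c).1 z = c := rfl

/-- The coordinate function. -/
def coord : boundedHolo :=
  ofFun (fun z => z) differentiableOn_id ⟨1, fun _ hz => (mem_ball_zero_iff.1 hz).le⟩

theorem coord_apply (z : Disc) : coord.1 z = z := rfl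

end boundedHolo

/-! ### Block operators and matrices of bounded holomorphic functions -/

theorem mulOp_apply {H K : Type*} [NormedAddCommGroup H] [InnerProductSpace ℂ H]
    [NormedAddCommGroup K] [InnerProductSpace ℂ K] [RKHS ℂ H (ball (0 : ℂ) 1) ℂ]
    [RKHS ℂ K (ball (0 : ℂ) 1) ℂ] {f : ℂ → ℂ} (h : IsMultiplier H K f) (g : H) (z : Disc) :
    mulOp H K f g z = f z * g z := by
  rw [mulOp, dif_pos h]
  exact h.choose_spec g z

theorem mulOp_congr {H K : Type*} [NormedAddCommGroup H] [InnerProductSpace ℂ H]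
    [NormedAddCommGroup K] [InnerProductSpace ℂ K] [RKHS ℂ H (ball (0 : ℂ) 1) ℂ]
    [RKHS ℂ K (ball (0 : ℂ) 1) ℂ] {f f' : ℂ → ℂ} (h : IsMultiplier H K f)
    (hff' : ∀ z : Disc, f z = f' z) : mulOp H K f = mulOp H K f' := by
  have h' : IsMultiplier H K f' := ⟨h.choose, fun g z => by rw [h.choose_spec, hff']⟩
  ext g : 1
  exact RKHS.ext fun z => by rw [mulOp_apply h, mulOp_apply h', hff']

section BlockOp

variable {n : ℕ} {H : Fin n → Type*} [∀ i, NormedAddCommGroup (H i)]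
  [∀ i, InnerProductSpace ℂ (H i)]

theorem blockOp_apply (A : ∀ i j, H j →L[ℂ] H i) (g : PiLp 2 H) (i : Fin n) :
    blockOp H A g i = ∑ j, A i j (g j) := by
  simp [blockOp]

theorem adjoint_blockOp [∀ i, CompleteSpace (H i)] (A : ∀ i j, H j →L[ℂ] H i) :
    ContinuousLinearMap.adjoint (blockOp H A) =
      blockOp H fun i j => ContinuousLinearMap.adjoint (A j i) := by
  symm
  rw [ContinuousLinearMap.eq_adjoint_iff]
  intro x y
  simp only [PiLp.inner_apply, blockOp_apply, sum_inner, inner_sum,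
    ContinuousLinearMap.adjoint_inner_left]
  exact Finset.sum_comm

end BlockOp

/-- The determinant is the product of the diagonal entries. That the inverse is again lower
triangular matters, since only such matrices are used as multiplication operators. -/
theorem Matrix.IsLowerTriangular.exists_inverse {n : ℕ} {R : Type*} [CommRing R]
    {A : Matrix (Fin n) (Fin n) R}
    (hA : A.IsLowerTriangular) (hu : ∀ i, IsUnit (A i i)) :
    ∃ B : Matrix (Fin n) (Fin n) R, B.IsLowerTriangular ∧ A * B = 1 ∧ B * A = 1 := by
  have hdet : IsUnit A.det := by
    rw [Matrix.det_of_isLowerTriangular A hA]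
    exact IsUnit.prod_univ_iff.2 hu
  let := Matrix.invertibleOfIsUnitDet A hdet
  exact ⟨A⁻¹, Matrix.blockTriangular_inv_of_blockTriangular hA, Matrix.mul_nonsing_inv A hdet,
    Matrix.nonsing_inv_mul A hdet⟩

variable {n : ℕ} {lam : Fin n → ℝ}

/-- The Hilbert direct sum of the spaces with exponents `lam i`. -/
abbrev DiscSum (lam : Fin n → ℝ) (h : ∀ i, 0 < lam i) : Type :=
  PiLp 2 fun i => DiscSpace (lam i) (h i)

theorem DiscSum.ext {h : ∀ i, 0 < lam i} {g g' : DiscSum lam h}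
    (hgg' : ∀ i (z : Disc), g i z = g' i z) : g = g' :=
  PiLp.ext fun i => RKHS.ext fun z => hgg' i z

/-- Multiplication by a lower triangular matrix of bounded holomorphic functions. -/
noncomputable def matOp (h : ∀ i, 0 < lam i) (A : Matrix (Fin n) (Fin n) boundedHolo) :
    DiscSum lam h →L[ℂ] DiscSum lam h :=
  blockOp (fun i => DiscSpace (lam i) (h i)) fun i j =>
    mulOp (DiscSpace (lam j) (h j)) (DiscSpace (lam i) (h i)) (boundedHolo.extend (A i j))

/-- Here triangularity meets the ordering of the exponents: for j ≤ i the target has the larger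
exponent, and for j > i the entry is zero. -/
theorem isMultiplier_extend (hl : ∀ i, 1 ≤ lam i) (hmono : Monotone lam) (h : ∀ i, 0 < lam i)
    {A : Matrix (Fin n) (Fin n) boundedHolo} (hA : A.IsLowerTriangular) (i j : Fin n) :
    IsMultiplier (DiscSpace (lam j) (h j)) (DiscSpace (lam i) (h i)) (boundedHolo.extend (A i j)) := by
  rcases le_or_gt j i with hij | hij
  · exact DiscSpace.isMultiplier (hl j) (hmono hij) (h j) (h i)
      (boundedHolo.differentiableOn_extend (A i j)) (boundedHolo.bounded_extend (A i j))
  · refine ⟨0, fun g z => ?_⟩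
    rw [boundedHolo.extend_apply, hA hij]
    simp

theorem matOp_apply (hl : ∀ i, 1 ≤ lam i) (hmono : Monotone lam) (h : ∀ i, 0 < lam i)
    {A : Matrix (Fin n) (Fin n) boundedHolo} (hA : A.IsLowerTriangular) (g : DiscSum lam h)
    (i : Fin n) (z : Disc) : matOp h A g i z = ∑ j, (A i j).1 z * g j z := by
  rw [matOp, blockOp_apply]
  have : (∑ j, mulOp (DiscSpace (lam j) (h j)) (DiscSpace (lam i) (h i)) (boundedHolo.extend (A i j)) (g j)) z =
      ∑ j, mulOp (DiscSpace (lam j) (h j)) (DiscSpace (lam i) (h i)) (boundedHolo.extend (A i j)) (g j) z := by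
    simp only [← DiscSpace.evalCLM_apply, map_sum]
  rw [this]
  exact Finset.sum_congr rfl fun j _ => by
    rw [mulOp_apply (isMultiplier_extend hl hmono h hA i j), boundedHolo.extend_apply]

theorem matOp_mul (hl : ∀ i, 1 ≤ lam i) (hmono : Monotone lam) (h : ∀ i, 0 < lam i)
    {A B : Matrix (Fin n) (Fin n) boundedHolo} (hA : A.IsLowerTriangular) (hB : B.IsLowerTriangular) :
    matOp h (A * B) = matOp h A * matOp h B := by
  ext g : 1
  refine DiscSum.ext fun i z => ?_
  rw [matOp_apply hl hmono h (hA.mul hB)]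
  change _ = matOp h A (matOp h B g) i z
  rw [matOp_apply hl hmono h hA]
  simp only [matOp_apply hl hmono h hB, Matrix.mul_apply, Finset.mul_sum]
  rw [Finset.sum_comm]
  refine Finset.sum_congr rfl fun j _ => ?_
  have e : (∑ k, A i k * B k j : boundedHolo).1 z = ∑ k, (A i k).1 z * (B k j).1 z := by
    simp
  rw [e, Finset.sum_mul]
  exact Finset.sum_congr rfl fun k _ => mul_assoc _ _ _

theorem matOp_sub (hl : ∀ i, 1 ≤ lam i) (hmono : Monotone lam) (h : ∀ i, 0 < lam i)
    {A B : Matrix (Fin n) (Fin n) boundedHolo} (hA : A.IsLowerTriangular) (hB : B.IsLowerTriangular) :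
    matOp h (A - B) = matOp h A - matOp h B := by
  ext g : 1
  refine DiscSum.ext fun i z => ?_
  rw [matOp_apply hl hmono h (hA.sub hB), sub_apply, PiLp.sub_apply, RKHS.coe_sub, Pi.sub_apply,
    matOp_apply hl hmono h hA, matOp_apply hl hmono h hB, ← Finset.sum_sub_distrib]
  exact Finset.sum_congr rfl fun j _ => sub_mul _ _ _

theorem matOp_const_smul (hl : ∀ i, 1 ≤ lam i) (hmono : Monotone lam) (h : ∀ i, 0 < lam i)
    {A : Matrix (Fin n) (Fin n) boundedHolo} (c : ℂ) (hA : A.IsLowerTriangular) :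
    matOp h (boundedHolo.const c • A) = c • matOp h A := by
  have hA' : (boundedHolo.const c • A).IsLowerTriangular := fun i j hij => by
    rw [Matrix.smul_apply, hA hij, smul_zero]
  ext g : 1
  refine DiscSum.ext fun i z => ?_
  rw [matOp_apply hl hmono h hA', smul_apply, PiLp.smul_apply, RKHS.coe_smul, Pi.smul_apply,
    matOp_apply hl hmono h hA, smul_eq_mul, Finset.mul_sum]
  exact Finset.sum_congr rfl fun j _ => mul_assoc _ _ _

theorem matOp_one (hl : ∀ i, 1 ≤ lam i) (hmono : Monotone lam) (h : ∀ i, 0 < lam i) :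
    matOp h (1 : Matrix (Fin n) (Fin n) boundedHolo) = 1 := by
  ext g : 1
  refine DiscSum.ext fun i z => ?_
  rw [matOp_apply hl hmono h Matrix.blockTriangular_one, Finset.sum_eq_single i]
  · simp
  · intro j _ hj
    simp [Matrix.one_apply_ne hj.symm]
  · simp

theorem isUnit_matOp (hl : ∀ i, 1 ≤ lam i) (hmono : Monotone lam) (h : ∀ i, 0 < lam i)
    {A : Matrix (Fin n) (Fin n) boundedHolo} 
    (hA : A.IsLowerTriangular) (hu : ∀ i, IsUnit (A i i)) :
    IsUnit (matOp h A) := by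
  obtain ⟨B, hB, h1, h2⟩ := hA.exists_inverse hu
  refine ⟨⟨matOp h A, matOp h B, ?_, ?_⟩, rfl⟩
  · rw [← matOp_mul hl hmono h hA hB, h1, matOp_one hl hmono]
  · rw [← matOp_mul hl hmono h hB hA, h2, matOp_one hl hmono]

/-! ### Conjugating triangular matrices to a shift -/

section Krylov

variable {R : Type*} [CommRing R] {n : ℕ}

theorem Matrix.pow_apply_eq_zero_of_strictlyLower {N : Matrix (Fin n) (Fin n) R}
    (hN : ∀ i j, i ≤ j → N i j = 0) (k : ℕ) (i j : Fin n) (hij : (i : ℕ) < j + k) :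
    (N ^ k) i j = 0 := by
  induction k generalizing i with
  | zero => rw [pow_zero, Matrix.one_apply_ne]; rintro rfl; omega
  | succ k ih =>
    rw [pow_succ', Matrix.mul_apply]
    refine Finset.sum_eq_zero fun l _ => ?_
    rcases le_or_gt i l with h | h
    · rw [hN i l h, zero_mul]
    · rw [ih l (by have : (l : ℕ) < i := h; omega), mul_zero]

/-- Only the path of k consecutive unit steps contributes, so the entry is a product of subdiagonal
entries. -/
theorem Matrix.isUnit_pow_apply_of_strictlyLower {N : Matrix (Fin n) (Fin n) R}
    (hN : ∀ i j, i ≤ j → N i j = 0) (hu : ∀ i j : Fin n, (i : ℕ) + 1 = j → IsUnit (N j i)) (k : ℕ)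
    (i j : Fin n) (hij : (i : ℕ) = j + k) : IsUnit ((N ^ k) i j) := by
  induction k generalizing i with
  | zero =>
    obtain rfl : i = j := Fin.ext hij
    simp
  | succ k ih =>
    have hl : (j : ℕ) + k < n := by have := i.2; omega
    rw [pow_succ', Matrix.mul_apply, Finset.sum_eq_single ⟨j + k, hl⟩]
    · exact (hu _ _ (by simp only; omega)).mul (ih _ rfl)
    · intro l _ hl'
      rcases le_or_gt i l with h | h
      · rw [hN i l h, zero_mul]
      · have h1 : (l : ℕ) < i := h
        have h2 : (l : ℕ) ≠ j + k := fun e => hl' (Fin.ext e)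
        rw [Matrix.pow_apply_eq_zero_of_strictlyLower hN k l j (by omega), mul_zero]
    · simp

/-- The lower shift matrix. -/
def Matrix.lowerShift (R : Type*) [CommRing R] (n : ℕ) : Matrix (Fin n) (Fin n) R :=
  Matrix.of fun i j => if (j : ℕ) + 1 = i then 1 else 0

/-- The first basis vector is cyclic for `N`: the columns of `K` are its images under the powers of
`N`, so applying `N` moves each column to the next. -/
theorem Matrix.exists_mul_lowerShift {N : Matrix (Fin n) (Fin n) R}
    (hN : ∀ i j, i ≤ j → N i j = 0) (hu : ∀ i j : Fin n, (i : ℕ) + 1 = j → IsUnit (N j i)) :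
    ∃ K : Matrix (Fin n) (Fin n) R, K.IsLowerTriangular ∧ (∀ i, IsUnit (K i i)) ∧
      N * K = K * Matrix.lowerShift R n := by
  rcases n with _ | n
  · exact ⟨1, Matrix.blockTriangular_one, fun i => i.elim0, by ext i; exact i.elim0⟩
  refine ⟨Matrix.of fun i j => (N ^ (j : ℕ)) i 0, fun i j hij => ?_, fun i => ?_, ?_⟩
  · have : i < j := hij
    exact Matrix.pow_apply_eq_zero_of_strictlyLower hN _ _ _ (by simpa using this)
  · exact Matrix.isUnit_pow_apply_of_strictlyLower hN hu _ _ _ (by simp)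
  · ext i j
    have h1 : (N * Matrix.of fun i j : Fin (n + 1) => (N ^ (j : ℕ)) i 0) i j =
        (N ^ ((j : ℕ) + 1)) i 0 := by
      rw [pow_succ', Matrix.mul_apply, Matrix.mul_apply]
      rfl
    rw [h1, Matrix.mul_apply]
    simp only [Matrix.lowerShift, Matrix.of_apply, mul_ite, mul_one, mul_zero]
    rcases Nat.lt_or_ge ((j : ℕ) + 1) (n + 1) with h | h
    · rw [Finset.sum_eq_single ⟨j + 1, h⟩]
      · simp
      · intro l _ hl
        rw [if_neg]
        exact fun e => hl (Fin.ext e.symm)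
      · simp
    -- For the last column there is no next one; both sides vanish since `N` is nilpotent.
    · rw [Matrix.pow_apply_eq_zero_of_strictlyLower hN _ _ _ (by simp; omega)]
      refine (Finset.sum_eq_zero fun l _ => ?_).symm
      rw [if_neg]
      have := l.2
      omega

/-- Lower triangular matrices with the same constant diagonal and invertible subdiagonal entries
are conjugate by a lower triangular matrix. -/
theorem Matrix.IsLowerTriangular.exists_conj {A B : Matrix (Fin n) (Fin n) R} {x : R}
    (hA : A.IsLowerTriangular) (hB : B.IsLowerTriangular) (hAx : ∀ i, A i i = x)
    (hBx : ∀ i, B i i = x) (hAu : ∀ i j : Fin n, (i : ℕ) + 1 = j → IsUnit (A j i))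
    (hBu : ∀ i j : Fin n, (i : ℕ) + 1 = j → IsUnit (B j i)) :
    ∃ P Q : Matrix (Fin n) (Fin n) R, P.IsLowerTriangular ∧ Q.IsLowerTriangular ∧
      P * Q = 1 ∧ Q * P = 1 ∧ A * P = P * B := by
  -- Both matrices are compared with the common model, shift plus `x`.
  have main : ∀ {A : Matrix (Fin n) (Fin n) R}, A.IsLowerTriangular → (∀ i, A i i = x) →
      (∀ i j : Fin n, (i : ℕ) + 1 = j → IsUnit (A j i)) →
      ∃ P Q : Matrix (Fin n) (Fin n) R, P.IsLowerTriangular ∧ Q.IsLowerTriangular ∧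
      P * Q = 1 ∧ Q * P = 1 ∧ A * P = P * (Matrix.lowerShift R n + x • 1) := by
    intro A hA hAx hAu
    obtain ⟨K, hK, hKu, h⟩ := Matrix.exists_mul_lowerShift (N := A - x • 1)
      (fun i j hij => by
        rcases hij.eq_or_lt with rfl | hij
        · simp [hAx]
        · simp [hA hij, Matrix.one_apply_ne hij.ne])
      (fun i j hij => by
        have : j ≠ i := by rintro rfl; omega
        simpa [Matrix.one_apply_ne this] using hAu i j hij)
    obtain ⟨L, hL, h1, h2⟩ := hK.exists_inverse hKu
    refine ⟨K, L, hK, hL, h1, h2, ?_⟩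
    rw [mul_add, ← h, sub_mul]
    simp
  obtain ⟨P, Q, hP, hQ, h1, h2, h3⟩ := main hA hAx hAu
  obtain ⟨P', Q', hP', hQ', h1', h2', h3'⟩ := main hB hBx hBu
  refine ⟨P * Q', P' * Q, hP.mul hQ', hP'.mul hQ, ?_, ?_, ?_⟩
  · rw [mul_assoc, ← mul_assoc Q', h2', one_mul, h1]
  · rw [mul_assoc, ← mul_assoc Q, h2, one_mul, h1']
  · rw [← mul_assoc, h3, mul_assoc, mul_assoc]
    congr 1
    calc (Matrix.lowerShift R n + x • 1) * Q' =
        Q' * P' * ((Matrix.lowerShift R n + x • 1) * Q') := by rw [h2', one_mul]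
      _ = Q' * (P' * (Matrix.lowerShift R n + x • 1)) * Q' := by simp only [mul_assoc]
      _ = Q' * B := by rw [← h3', mul_assoc, mul_assoc, h1', mul_one]

end Krylov

/-! ### Rigidity of intertwiners -/

section Rigidity

variable {n : ℕ} {lam : Fin n → ℝ} {h : ∀ i, 0 < lam i}

/-- The inclusion of a summand. -/
noncomputable def DiscSum.incl (h : ∀ i, 0 < lam i) (j : Fin n) :
    DiscSpace (lam j) (h j) →L[ℂ] DiscSum lam h :=
  ((PiLp.continuousLinearEquiv 2 ℂ fun i => DiscSpace (lam i) (h i)).symm :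
    (∀ i, DiscSpace (lam i) (h i)) →L[ℂ] DiscSum lam h).comp
    (ContinuousLinearMap.single ℂ (fun i => DiscSpace (lam i) (h i)) j)

theorem DiscSum.incl_apply (j i : Fin n) (g : DiscSpace (lam j) (h j)) :
    DiscSum.incl h j g i = (Pi.single j g : ∀ i, DiscSpace (lam i) (h i)) i := rfl

theorem DiscSum.sum_incl (g : DiscSum lam h) : ∑ j, DiscSum.incl h j (g j) = g := by
  refine PiLp.ext fun i => ?_
  have : (∑ j, DiscSum.incl h j (g j)) i = ∑ j, DiscSum.incl h j (g j) i := by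
    simp
  rw [this, Finset.sum_eq_single i]
  · simp [DiscSum.incl_apply]
  · intro j _ hj
    simp [DiscSum.incl_apply, hj.symm]
  · simp

/-- The block entries of an operator. -/
noncomputable def entry (X : DiscSum lam h →L[ℂ] DiscSum lam h) (i j : Fin n) :
    DiscSpace (lam j) (h j) →L[ℂ] DiscSpace (lam i) (h i) :=
  (PiLp.proj 2 (fun i => DiscSpace (lam i) (h i)) i).comp (X.comp (DiscSum.incl h j))

theorem entry_apply (X : DiscSum lam h →L[ℂ] DiscSum lam h) (i j : Fin n)
    (g : DiscSpace (lam j) (h j)) : entry X i j g = X (DiscSum.incl h j g) i := rfl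

theorem apply_eq_sum_entry (X : DiscSum lam h →L[ℂ] DiscSum lam h) (g : DiscSum lam h)
    (i : Fin n) (z : Disc) : X g i z = ∑ j, entry X i j (g j) z := by
  conv_lhs => rw [← DiscSum.sum_incl g, map_sum]
  have : (∑ j, X (DiscSum.incl h j (g j))) i = ∑ j, X (DiscSum.incl h j (g j)) i := by
    simp
  rw [this]
  simp only [← DiscSpace.evalCLM_apply, map_sum]
  rfl

theorem entry_one_self (i : Fin n) (g : DiscSpace (lam i) (h i)) :
    entry (1 : DiscSum lam h →L[ℂ] DiscSum lam h) i i g = g := by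
  simp [entry_apply, DiscSum.incl_apply]

theorem entry_mul_apply (X Z : DiscSum lam h →L[ℂ] DiscSum lam h) (i j : Fin n)
    (g : DiscSpace (lam j) (h j)) (z : Disc) :
    entry (X * Z) i j g z = ∑ k, entry X i k (entry Z k j g) z :=
  apply_eq_sum_entry X (Z (DiscSum.incl h j g)) i z

variable {A B : Matrix (Fin n) (Fin n) boundedHolo}

theorem entry_matOp_apply (hl : ∀ i, 1 ≤ lam i) (hmono : Monotone lam) (hA : A.IsLowerTriangular)
    (i j : Fin n) (g : DiscSpace (lam j) (h j)) (z : Disc) :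
    entry (matOp h A) i j g z = (A i j).1 z * g z := by
  rw [entry_apply, matOp_apply hl hmono h hA, Finset.sum_eq_single j]
  · simp [DiscSum.incl_apply]
  · intro k _ hk
    simp [DiscSum.incl_apply, hk]
  · simp

theorem entry_intertwine (hl : ∀ i, 1 ≤ lam i) (hmono : Monotone lam) (hB : B.IsLowerTriangular)
    {X : DiscSum lam h →L[ℂ] DiscSum lam h} (hX : X * matOp h A = matOp h B * X) (i j : Fin n)
    (g : DiscSpace (lam j) (h j)) (z : Disc) :
    ∑ k, entry X i k (entry (matOp h A) k j g) z = ∑ k, (B i k).1 z * entry X k j g z := by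
  rw [← entry_mul_apply, hX, entry_mul_apply]
  exact Finset.sum_congr rfl fun k _ => entry_matOp_apply hl hmono hB _ _ _ _

theorem entry_matOp_diag (hl : ∀ i, 1 ≤ lam i) (hmono : Monotone lam) (hA : A.IsLowerTriangular)
    (hAd : ∀ i, A i i = boundedHolo.coord) {j : Fin n} {g g' : DiscSpace (lam j) (h j)}
    (hg : ∀ z : Disc, g' z = z * g z) : entry (matOp h A) j j g = g' :=
  RKHS.ext fun z => by
    rw [entry_matOp_apply hl hmono hA, hAd, hg, boundedHolo.coord_apply]

theorem entry_matOp_eq_zero (hl : ∀ i, 1 ≤ lam i) (hmono : Monotone lam)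
    (hA : A.IsLowerTriangular) {i j : Fin n} (hij : i < j) : entry (matOp h A) i j = 0 := by
  ext g : 1
  refine RKHS.ext fun z => ?_
  rw [entry_matOp_apply hl hmono hA, hA hij]
  simp

/-- An intertwiner of two lower triangular multiplication operators with the coordinate function
on the diagonal is lower triangular. -/
theorem entry_eq_zero_of_intertwine (hl : ∀ i, 1 ≤ lam i) (hmono : Monotone lam)
    (hA : A.IsLowerTriangular) (hB : B.IsLowerTriangular) (hAd : ∀ i, A i i = boundedHolo.coord)
    (hBd : ∀ i, B i i = boundedHolo.coord)
    (hA0 : ∀ i j : Fin n, (i : ℕ) + 1 = j → ∃ z, (A j i).1 z ≠ 0)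
    {X : DiscSum lam h →L[ℂ] DiscSum lam h} (hX : X * matOp h A = matOp h B * X) (i j : Fin n)
    (hij : i < j) : entry X i j = 0 := by
  induction i using WellFoundedLT.induction generalizing j with
  | _ i ihi =>
  -- Inside the induction over rows from the top runs one over columns from the right, with `d`
  -- bounding the distance to the last column. The vanishing entries already known make the entry
  -- (i, j) commute with z, hence a multiplication by some `b`.
  obtain ⟨d, hd⟩ : ∃ d, n ≤ (j : ℕ) + d := ⟨n, by omega⟩
  induction d generalizing j with
  | zero => have := j.2; omega
  | succ d ihd =>
  have hright : ∀ k, j < k → entry X i k = 0 := fun k hk =>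
    ihd k (hij.trans hk) (by have : (j : ℕ) < k := hk; omega)
  have hcomm : ∀ g g' : DiscSpace (lam j) (h j), (∀ z : Disc, g' z = z * g z) →
      ∀ z : Disc, entry X i j g' z = z * entry X i j g z := by
    intro g g' hg z
    have e := entry_intertwine hl hmono hB hX i j g z
    rw [Finset.sum_eq_single j, Finset.sum_eq_single i, entry_matOp_diag hl hmono hA hAd hg, hBd,
      boundedHolo.coord_apply] at e
    · exact e
    · intro k _ hk
      rcases hk.lt_or_gt with hk | hk
      · rw [ihi k hk j (hk.trans hij)]
        simp
      · rw [hB hk]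
        simp
    · simp
    · intro k _ hk
      rcases hk.lt_or_gt with hk | hk
      · rw [entry_matOp_eq_zero hl hmono hA hk]
        simp
      · rw [hright k hk]
        simp
    · simp
  set b : DiscSpace (lam i) (h i) := entry X i j (DiscSpace.monomial (hl j) (h j) 0) with hb
  have hmul : ∀ g z, entry X i j g z = b z * g z :=
    DiscSpace.apply_eq_mul_of_commute (hl j) (h j) (h i) _ hcomm
  have hij' : (i : ℕ) < j := hij
  obtain ⟨p, hp⟩ : ∃ p : Fin n, (p : ℕ) + 1 = j :=
    ⟨⟨j - 1, by have := j.2; omega⟩, by simp only; omega⟩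
  have hpj : p < j := Fin.lt_def.2 (by omega)
  have hip : i ≤ p := Fin.le_def.2 (by omega)
  -- One column to the left, the relation exhibits multiplication by −b A_{jp} as the commutator of
  -- the entry (i, p) with z. Here `lam i ≤ lam p`, so it vanishes, and `A j p` is not identically
  -- zero.
  have hzero : ∀ z, -(b z * (A j p).1 z) = 0 := by
    refine DiscSpace.eq_zero_of_commutator (hl p) (hl i) (by linarith [hmono hip]) (h p) (h i)
      (entry X i p) (fun z => -(b z * (A j p).1 z)) fun g g' hg z => ?_
    have e := entry_intertwine hl hmono hB hX i p g z
    rw [Finset.sum_eq_add p j hpj.ne, Finset.sum_eq_single i,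
      entry_matOp_diag hl hmono hA hAd hg, hBd, hmul, entry_matOp_apply hl hmono hA,
      boundedHolo.coord_apply] at e
    · rw [← e]
      ring
    · intro k _ hk
      rcases hk.lt_or_gt with hk | hk
      · rw [ihi k hk p (hk.trans_le hip)]
        simp
      · rw [hB hk]
        simp
    · simp
    · rintro k _ ⟨hkp, hkj⟩
      rcases hkp.lt_or_gt with hk | hk
      · rw [entry_matOp_eq_zero hl hmono hA hk]
        simp
      · have h1 : (p : ℕ) < k := hk
        have h2 : (k : ℕ) ≠ j := fun e => hkj (Fin.ext e)
        rw [hright k (Fin.lt_def.2 (by omega))]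
        simp
    · simp
    · simp
  obtain ⟨F, hF, hFb⟩ := DiscSpace.exists_differentiableOn (hl i) (h i) b
  ext g : 1
  refine RKHS.ext fun z => ?_
  have hFz := eq_zero_of_mul_eq_zero_on_disc hF (boundedHolo.differentiableOn_extend (A j p))
    (by simpa only [boundedHolo.extend_apply] using hA0 p j hp)
    (fun z => by rw [← hFb, boundedHolo.extend_apply]; exact neg_eq_zero.1 (hzero z)) z
  rw [hmul, hFb, hFz]
  simp

/-- The diagonal entries of an intertwiner are multiplication operators. -/
theorem exists_entry_diag_eq_mul (hl : ∀ i, 1 ≤ lam i) (hmono : Monotone lam)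
    (hA : A.IsLowerTriangular) (hB : B.IsLowerTriangular) (hAd : ∀ i, A i i = boundedHolo.coord)
    (hBd : ∀ i, B i i = boundedHolo.coord)
    (hA0 : ∀ i j : Fin n, (i : ℕ) + 1 = j → ∃ z, (A j i).1 z ≠ 0)
    {X : DiscSum lam h →L[ℂ] DiscSum lam h} (hX : X * matOp h A = matOp h B * X) (i : Fin n) :
    ∃ b : Disc → ℂ, ∀ g z, entry X i i g z = b z * g z := by
  refine ⟨entry X i i (DiscSpace.monomial (hl i) (h i) 0),
    DiscSpace.apply_eq_mul_of_commute (hl i) (h i) (h i) _ fun g g' hg z => ?_⟩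
  have hup := entry_eq_zero_of_intertwine hl hmono hA hB hAd hBd hA0 hX
  have e := entry_intertwine hl hmono hB hX i i g z
  rw [Finset.sum_eq_single i, Finset.sum_eq_single i, entry_matOp_diag hl hmono hA hAd hg, hBd,
    boundedHolo.coord_apply] at e
  · exact e
  · intro k _ hk
    rcases hk.lt_or_gt with hk | hk
    · rw [hup k i hk]
      simp
    · rw [hB hk]
      simp
  · simp
  · intro k _ hk
    rcases hk.lt_or_gt with hk | hk
    · rw [entry_matOp_eq_zero hl hmono hA hk]
      simp
    · rw [hup i k hk]
      simp
  · simp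

/-- Similarity of two lower triangular multiplication operators with the coordinate function on the
diagonal makes their subdiagonal entries comparable. -/
theorem exists_norm_subdiag_le (hl : ∀ i, 1 ≤ lam i) (hmono : Monotone lam)
    (hstep : ∀ i j : Fin n, (i : ℕ) + 1 = j → lam j < lam i + 2)
    (hA : A.IsLowerTriangular) (hB : B.IsLowerTriangular) (hAd : ∀ i, A i i = boundedHolo.coord)
    (hBd : ∀ i, B i i = boundedHolo.coord)
    (hA0 : ∀ i j : Fin n, (i : ℕ) + 1 = j → ∃ z, (A j i).1 z ≠ 0)
    (hB0 : ∀ i j : Fin n, (i : ℕ) + 1 = j → ∃ z, (B j i).1 z ≠ 0)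
    (hconj : IsConj (matOp h A) (matOp h B)) {i j : Fin n} (hij : (i : ℕ) + 1 = j) :
    ∃ C : ℝ, ∀ z, ‖(B j i).1 z‖ ≤ C * ‖(A j i).1 z‖ := by
  obtain ⟨u, hu⟩ := hconj
  obtain ⟨X, Z, hXZ, hX, hZ⟩ : ∃ X Z : DiscSum lam h →L[ℂ] DiscSum lam h, X * Z = 1 ∧
      X * matOp h A = matOp h B * X ∧ Z * matOp h B = matOp h A * Z := by
    refine ⟨u, (u⁻¹ : (DiscSum lam h →L[ℂ] DiscSum lam h)ˣ), u.mul_inv, hu, ?_⟩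
    rw [Units.inv_mul_eq_iff_eq_mul, ← mul_assoc, hu.eq, mul_assoc, Units.mul_inv, mul_one]
  have hupX := entry_eq_zero_of_intertwine hl hmono hA hB hAd hBd hA0 hX
  obtain ⟨a, ha⟩ := exists_entry_diag_eq_mul hl hmono hA hB hAd hBd hA0 hX i
  obtain ⟨b, hb⟩ := exists_entry_diag_eq_mul hl hmono hA hB hAd hBd hA0 hX j
  have hupZ := entry_eq_zero_of_intertwine hl hmono hB hA hBd hAd hB0 hZ
  obtain ⟨c, hc⟩ := exists_entry_diag_eq_mul hl hmono hB hA hBd hAd hB0 hZ i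
  -- `X` and its inverse `Z` are both lower triangular, so their diagonal symbols are reciprocal.
  have hac : ∀ z, a z * c z = 1 := by
    intro z
    have e := entry_mul_apply X Z i i (DiscSpace.monomial (hl i) (h i) 0) z
    rw [hXZ, entry_one_self, Finset.sum_eq_single i, ha, hc, DiscSpace.monomial_apply] at e
    · simpa using e.symm
    · intro k _ hk
      rcases hk.lt_or_gt with hk | hk
      · rw [hupZ k i hk]
        simp
      · rw [hupX i k hk]
        simp
    · simp
  have hij' : i < j := Fin.lt_def.2 (by omega)
  -- This difference is the commutator of the entry (j, i) of `X` with z; the gap condition `lam j <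
  -- lam i + 2` is what kills it.
  have hzero : ∀ z, (B j i).1 z * a z - b z * (A j i).1 z = 0 := by
    refine DiscSpace.eq_zero_of_commutator (hl i) (hl j) (hstep i j hij) (h i) (h j)
      (entry X j i) (fun z => (B j i).1 z * a z - b z * (A j i).1 z) fun g g' hg z => ?_
    have e := entry_intertwine hl hmono hB hX j i g z
    rw [Finset.sum_eq_add i j hij'.ne, Finset.sum_eq_add i j hij'.ne,
      entry_matOp_diag hl hmono hA hAd hg, hBd, ha, hb, entry_matOp_apply hl hmono hA,
      boundedHolo.coord_apply] at e
    · linear_combination e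
    · rintro k _ ⟨hki, hkj⟩
      rcases hki.lt_or_gt with hk | hk
      · rw [hupX k i hk]
        simp
      · have h1 : (i : ℕ) < k := hk
        have h2 : (k : ℕ) ≠ j := fun e => hkj (Fin.ext e)
        have h3 : j < k := Fin.lt_def.2 (by omega)
        rw [hB h3]
        simp
    · simp
    · simp
    · rintro k _ ⟨hki, hkj⟩
      rcases hki.lt_or_gt with hk | hk
      · rw [entry_matOp_eq_zero hl hmono hA hk]
        simp
      · have h1 : (i : ℕ) < k := hk
        have h2 : (k : ℕ) ≠ j := fun e => hkj (Fin.ext e)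
        rw [hupX j k (Fin.lt_def.2 (by omega))]
        simp
    · simp
    · simp
  refine ⟨‖entry X j j‖ * ‖entry Z i i‖, fun z => ?_⟩
  have e : (B j i).1 z = b z * c z * (A j i).1 z := by
    linear_combination c z * hzero z - (B j i).1 z * hac z
  rw [e, norm_mul, norm_mul]
  gcongr
  · exact DiscSpace.norm_multiplier_le (h j) _ hb z
  · exact DiscSpace.norm_multiplier_le (h i) _ hc z

end Rigidity

/-! ### Möbius maps and composition operators -/

section Moebius

/-- The Möbius map `z ↦ c (z - a) / (1 - ā z)`. -/
noncomputable def moebius (c a z : ℂ) : ℂ := c * (z - a) / (1 - conj a * z)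

theorem one_sub_conj_mul_ne_zero {a z : ℂ} (ha : ‖a‖ < 1) (hz : ‖z‖ ≤ 1) : 1 - conj a * z ≠ 0 := by
  intro h
  have h1 : ‖conj a * z‖ = 1 := by rw [← sub_eq_zero.1 h]; simp
  rw [norm_mul, RCLike.norm_conj] at h1
  nlinarith [norm_nonneg a, norm_nonneg z]

theorem one_sub_moebius_mul_conj {c a z w : ℂ} (hc : ‖c‖ = 1) (ha : ‖a‖ < 1) (hz : ‖z‖ < 1)
    (hw : ‖w‖ < 1) : (1 - moebius c a z * conj (moebius c a w)) *
      (1 - conj a * z) = (1 - a * conj a) / (1 - a * conj w) * (1 - z * conj w) := by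
  have h1 := one_sub_conj_mul_ne_zero ha hz.le
  have h2 : 1 - a * conj w ≠ 0 := by
    have := (map_ne_zero (starRingEnd ℂ)).2 (one_sub_conj_mul_ne_zero ha hw.le)
    simpa using this
  have h3 : c * conj c = 1 := by rw [Complex.mul_conj', hc]; simp
  simp only [moebius, map_div₀, map_mul, map_sub, map_one, Complex.conj_conj]
  generalize conj a = a', conj w = w', conj c = c' at *
  have h1' : 1 - z * a' ≠ 0 := by rwa [mul_comm]
  field_simp
  linear_combination (-(z - a) * (w' - a')) * h3

theorem norm_moebius_lt_one {c a z : ℂ} (hc : ‖c‖ = 1) (ha : ‖a‖ < 1) (hz : ‖z‖ < 1) :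
    ‖moebius c a z‖ < 1 := by
  have h1 := one_sub_conj_mul_ne_zero ha hz.le
  rw [moebius, norm_div, norm_mul, hc, one_mul, div_lt_one (norm_pos_iff.2 h1),
    ← sq_lt_sq₀ (norm_nonneg _) (norm_nonneg _)]
  have e : ‖1 - conj a * z‖ ^ 2 - ‖z - a‖ ^ 2 = (1 - ‖z‖ ^ 2) * (1 - ‖a‖ ^ 2) := by
    simp only [← Complex.normSq_eq_norm_sq, Complex.normSq_apply, Complex.sub_re,
      Complex.sub_im, Complex.mul_re, Complex.mul_im, Complex.conj_re, Complex.conj_im,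
      Complex.one_re, Complex.one_im]
    ring
  have h2 : 0 < 1 - ‖z‖ ^ 2 := by nlinarith [norm_nonneg z]
  have h3 : 0 < 1 - ‖a‖ ^ 2 := by nlinarith [norm_nonneg a]
  nlinarith [mul_pos h2 h3]

theorem moebius_inverse {c a z : ℂ} (hc : ‖c‖ = 1) (ha : ‖a‖ < 1) (hz : ‖z‖ < 1) :
    moebius (conj c) (-(c * a)) (moebius c a z) = z := by
  have h1 := one_sub_conj_mul_ne_zero ha hz.le
  have h3 : c * conj c = 1 := by rw [Complex.mul_conj', hc]; simp
  have h4 : 1 - a * conj a ≠ 0 := by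
    have := one_sub_conj_mul_ne_zero ha ha.le
    rwa [mul_comm] at this
  have h5 : 1 - conj (-(c * a)) * (c * (z - a) / (1 - conj a * z)) =
      (1 - a * conj a) / (1 - conj a * z) := by
    simp only [map_neg, map_mul]
    generalize conj a = a', conj c = c' at *
    field_simp
    linear_combination (a' * (z - a)) * h3
  rw [moebius, moebius, h5]
  generalize conj a = a', conj c = c' at *
  have h1' : 1 - z * a' ≠ 0 := by rwa [mul_comm]
  field_simp
  linear_combination (z - a * a' * z) * h3

theorem differentiableOn_moebius {c a : ℂ} (ha : ‖a‖ < 1) :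
    DifferentiableOn ℂ (moebius c a) (ball 0 1) :=
  (DifferentiableOn.const_mul (differentiableOn_id.sub_const _) _).div
    ((differentiableOn_const _).sub (differentiableOn_id.const_mul _))
    fun _ hz => one_sub_conj_mul_ne_zero ha (mem_ball_zero_iff.1 hz).le

/-- The Möbius map as a self-map of the disc. -/
noncomputable def Disc.moebius {c a : ℂ} (hc : ‖c‖ = 1) (ha : ‖a‖ < 1) (z : Disc) : Disc :=
  ⟨_root_.moebius c a z, mem_ball_zero_iff.2 (norm_moebius_lt_one hc ha z.norm_lt_one)⟩

theorem Disc.coe_moebius {c a : ℂ} (hc : ‖c‖ = 1) (ha : ‖a‖ < 1) (z : Disc) :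
    (Disc.moebius hc ha z : ℂ) = _root_.moebius c a z := rfl

theorem re_one_sub_pos {u : ℂ} (hu : ‖u‖ < 1) : 0 < (1 - u).re := by
  have := (Complex.re_le_norm u).trans_lt hu
  simpa using this

theorem one_sub_mem_slitPlane {u : ℂ} (hu : ‖u‖ < 1) : 1 - u ∈ Complex.slitPlane :=
  Or.inl (re_one_sub_pos hu)

theorem norm_mul_lt_one {u v : ℂ} (hu : ‖u‖ < 1) (hv : ‖v‖ < 1) : ‖u * v‖ < 1 := by
  rw [norm_mul]
  nlinarith [norm_nonneg u, norm_nonneg v]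

/-- The logarithmic form of the product identity holds exactly for principal branches: the
logarithmic derivative of that identity shows the left side to be constant in `z`, and at z = a the
Möbius map vanishes. No multiple of 2πi has to be tracked. -/
theorem log_one_sub_moebius {c a z w : ℂ} (hc : ‖c‖ = 1) (ha : ‖a‖ < 1) (hz : ‖z‖ < 1)
    (hw : ‖w‖ < 1) : Complex.log (1 - moebius c a z * conj (moebius c a w)) +
      Complex.log (1 - conj a * z) - Complex.log (1 - z * conj w) =
      Complex.log (1 - conj a * a) - Complex.log (1 - a * conj w) := by
  set b := conj (moebius c a w) with hb
  have hbn : ‖b‖ < 1 := by rw [hb, RCLike.norm_conj]; exact norm_moebius_lt_one hc ha hw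
  have hwn : ‖conj w‖ < 1 := by rwa [RCLike.norm_conj]
  have han : ‖conj a‖ < 1 := by rwa [RCLike.norm_conj]
  set P : ℂ → ℂ := fun z => 1 - moebius c a z * b with hP
  set Q : ℂ → ℂ := fun z => 1 - conj a * z with hQ
  set S : ℂ → ℂ := fun z => 1 - z * conj w with hS
  have hPm : ∀ z ∈ ball (0 : ℂ) 1, P z ∈ Complex.slitPlane := fun z hz =>
    one_sub_mem_slitPlane (norm_mul_lt_one (norm_moebius_lt_one hc ha (mem_ball_zero_iff.1 hz)) hbn)
  have hQm : ∀ z ∈ ball (0 : ℂ) 1, Q z ∈ Complex.slitPlane := fun z hz =>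
    one_sub_mem_slitPlane (norm_mul_lt_one han (mem_ball_zero_iff.1 hz))
  have hSm : ∀ z ∈ ball (0 : ℂ) 1, S z ∈ Complex.slitPlane := fun z hz =>
    one_sub_mem_slitPlane (norm_mul_lt_one (mem_ball_zero_iff.1 hz) hwn)
  have hPd : ∀ z ∈ ball (0 : ℂ) 1, DifferentiableAt ℂ P z := fun z hz =>
    (((differentiableOn_moebius ha).differentiableAt (isOpen_ball.mem_nhds hz)).mul_const
      b).const_sub 1
  have hQd : ∀ z, DifferentiableAt ℂ Q z := fun z => by fun_prop
  have hSd : ∀ z, DifferentiableAt ℂ S z := fun z => by fun_prop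
  have hκ : (1 - a * conj a) / (1 - a * conj w) ≠ 0 := by
    refine div_ne_zero ?_ ?_
    · exact Complex.slitPlane_ne_zero (one_sub_mem_slitPlane (norm_mul_lt_one ha han))
    · exact Complex.slitPlane_ne_zero (one_sub_mem_slitPlane (norm_mul_lt_one ha hwn))
  have hderiv : ∀ z ∈ ball (0 : ℂ) 1,
      HasDerivAt (fun z => Complex.log (P z) + Complex.log (Q z) - Complex.log (S z)) 0 z := by
    intro z hz
    have h1 := ((hPd z hz).hasDerivAt.clog (hPm z hz)).add ((hQd z).hasDerivAt.clog (hQm z hz))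
      |>.sub ((hSd z).hasDerivAt.clog (hSm z hz))
    refine h1.congr_deriv ?_
    have hev : (fun z => P z * Q z) =ᶠ[nhds z]
        fun z => (1 - a * conj a) / (1 - a * conj w) * S z := by
      filter_upwards [isOpen_ball.mem_nhds hz] with x hx
      exact one_sub_moebius_mul_conj hc ha (mem_ball_zero_iff.1 hx) hw
    have h2 : logDeriv (fun z => P z * Q z) z =
        logDeriv (fun z => (1 - a * conj a) / (1 - a * conj w) * S z) z := by
      simp only [logDeriv_apply]
      rw [hev.deriv_eq, hev.eq_of_nhds]
    rw [logDeriv_mul _ (Complex.slitPlane_ne_zero (hPm z hz)) (Complex.slitPlane_ne_zero (hQm z hz))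
      (hPd z hz) (hQd z), logDeriv_const_mul _ _ hκ] at h2
    simp only [logDeriv_apply] at h2
    rw [h2, sub_self]
  have hconst := isOpen_ball.is_const_of_deriv_eq_zero (convex_ball (0 : ℂ) 1).isPreconnected
    (fun z hz => (hderiv z hz).differentiableAt.differentiableWithinAt)
    (fun z hz => (hderiv z hz).deriv) (mem_ball_zero_iff.2 hz) (mem_ball_zero_iff.2 ha)
  simp only [hP, hQ, hS] at hconst
  rw [hconst]
  simp [moebius]

/-- Exponentiating the logarithmic identity splits the change of the kernel into a function of `z`
times the conjugate of the same function of `w`, as a multiplier would. -/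
theorem scalarKernel_moebius (l : ℝ) {c a : ℂ} (hc : ‖c‖ = 1) (ha : ‖a‖ < 1) (z w : Disc) :
    scalarKernel l (Disc.moebius hc ha z) (Disc.moebius hc ha w) =
      ((1 - ‖a‖ ^ 2) ^ (-l) : ℝ) *
        ((1 - conj a * z) ^ (l : ℂ) * conj ((1 - conj a * w) ^ (l : ℂ))) * scalarKernel l z w := by
  have hz := z.norm_lt_one
  have hw := w.norm_lt_one
  have hwn : ‖conj (w : ℂ)‖ < 1 := by rwa [RCLike.norm_conj]
  have han : ‖conj a‖ < 1 := by rwa [RCLike.norm_conj]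
  have h := log_one_sub_moebius hc ha hz hw
  have n1 : 1 - moebius c a z * conj (moebius c a w) ≠ 0 :=
    Disc.one_sub_mul_conj_ne_zero (Disc.moebius hc ha z) (Disc.moebius hc ha w)
  have n2 := one_sub_conj_mul_ne_zero ha hz.le
  have n3 := Disc.one_sub_mul_conj_ne_zero z w
  have n4 := one_sub_conj_mul_ne_zero ha ha.le
  have s5 : 1 - conj a * (w : ℂ) ∈ Complex.slitPlane :=
    one_sub_mem_slitPlane (norm_mul_lt_one han hw)
  have n5 : 1 - a * conj (w : ℂ) ≠ 0 :=
    Complex.slitPlane_ne_zero (one_sub_mem_slitPlane (norm_mul_lt_one ha hwn))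
  have e1 : conj ((1 - conj a * (w : ℂ)) ^ (l : ℂ)) = (1 - a * conj (w : ℂ)) ^ (l : ℂ) := by
    have := Complex.conj_cpow (1 - conj a * (w : ℂ)) (l : ℂ) (Complex.slitPlane_arg_ne_pi s5)
    rw [Complex.conj_ofReal] at this
    rw [← this]
    simp
  have ht : 0 ≤ 1 - ‖a‖ ^ 2 := by nlinarith [norm_nonneg a]
  have e2 : (((1 - ‖a‖ ^ 2) ^ (-l) : ℝ) : ℂ) = (1 - conj a * a) ^ (-l : ℂ) := by
    rw [Complex.ofReal_cpow ht, Complex.conj_mul']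
    push_cast
    rfl
  rw [e1, e2, scalarKernel, scalarKernel, one_div, one_div, ← Complex.cpow_neg, ← Complex.cpow_neg,
    Disc.coe_moebius, Disc.coe_moebius, Complex.cpow_def_of_ne_zero n1,
    Complex.cpow_def_of_ne_zero n2, Complex.cpow_def_of_ne_zero n3, Complex.cpow_def_of_ne_zero n4,
    Complex.cpow_def_of_ne_zero n5, ← Complex.exp_add, ← Complex.exp_add, ← Complex.exp_add]
  congr 1
  linear_combination (-(l : ℂ)) * h

/-- By the transformation rule, the positivity required for composition is that of the multiplier √t
(1 − ā z)^l, which is bounded by √t 2^l. -/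
theorem DiscSpace.exists_comp_moebius {l : ℝ} (hl : 1 ≤ l) (hl0 : 0 < l) {c a : ℂ} (hc : ‖c‖ = 1)
    (ha : ‖a‖ < 1) : ∃ L : DiscSpace l hl0 →L[ℂ] DiscSpace l hl0,
      ∀ g z, L g z = g (Disc.moebius hc ha z) := by
  have han : ‖conj a‖ < 1 := by rwa [RCLike.norm_conj]
  have ht : 0 < 1 - ‖a‖ ^ 2 := by nlinarith [norm_nonneg a]
  set t := (1 - ‖a‖ ^ 2) ^ (-l) with htdef
  have ht0 : 0 < t := by positivity
  have hb : ∀ z ∈ ball (0 : ℂ) 1, ‖(Real.sqrt t : ℂ) * (1 - conj a * z) ^ (l : ℂ)‖ ≤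
      Real.sqrt t * 2 ^ l := by
    intro z hz
    rw [norm_mul, Complex.norm_real, Real.norm_of_nonneg (Real.sqrt_nonneg _),
      Complex.norm_cpow_real]
    gcongr
    refine (norm_sub_le _ _).trans ?_
    have := (norm_mul_lt_one han (mem_ball_zero_iff.1 hz)).le
    rw [norm_one]
    linarith
  have hd : DifferentiableOn ℂ (fun z => (Real.sqrt t : ℂ) * (1 - conj a * z) ^ (l : ℂ))
      (ball 0 1) := fun z hz => by
    refine DifferentiableAt.differentiableWithinAt (DifferentiableAt.const_mul ?_ _)
    exact DifferentiableAt.cpow (by fun_prop) (by fun_prop)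
      (one_sub_mem_slitPlane (norm_mul_lt_one han (mem_ball_zero_iff.1 hz)))
  have hC : 0 < Real.sqrt t * 2 ^ l := by positivity
  obtain ⟨L, -, hL⟩ := DiscSpace.exists_weightedComp hl0 hl0 hC.le (Disc.moebius hc ha) (fun _ => 1) (by
    convert PosKernel.multiplier hC hl le_rfl hd hb using 4 with z w
    rw [scalarKernel_moebius, map_mul, Complex.conj_ofReal, map_one, one_mul, one_mul]
    have : (t : ℂ) = (Real.sqrt t : ℂ) * (Real.sqrt t : ℂ) := by
      rw [← Complex.ofReal_mul, Real.mul_self_sqrt ht0.le]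
    rw [← htdef, this]
    ring)
  exact ⟨L, fun g z => by rw [hL, one_mul]⟩

variable {n : ℕ} {lam : Fin n → ℝ}

/-- Composition with a Möbius map in every summand. -/
theorem DiscSum.exists_comp_moebius (hl : ∀ i, 1 ≤ lam i) (h : ∀ i, 0 < lam i) {c a : ℂ}
    (hc : ‖c‖ = 1) (ha : ‖a‖ < 1) : ∃ W : DiscSum lam h →L[ℂ] DiscSum lam h,
      ∀ g i z, W g i z = g i (Disc.moebius hc ha z) := by
  choose L hL using fun i => DiscSpace.exists_comp_moebius (hl i) (h i) hc ha
  refine ⟨((PiLp.continuousLinearEquiv 2 ℂ fun i => DiscSpace (lam i) (h i)).symm :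
    (∀ i, DiscSpace (lam i) (h i)) →L[ℂ] DiscSum lam h).comp
    (ContinuousLinearMap.pi fun i =>
      (L i).comp (PiLp.proj 2 (fun i => DiscSpace (lam i) (h i)) i)), fun g i z => ?_⟩
  exact hL i (g i) z

theorem norm_conj_eq_one {c : ℂ} (hc : ‖c‖ = 1) : ‖conj c‖ = 1 := by rwa [RCLike.norm_conj]

theorem norm_neg_mul_lt_one {c a : ℂ} (hc : ‖c‖ = 1) (ha : ‖a‖ < 1) : ‖-(c * a)‖ < 1 := by
  rwa [norm_neg, norm_mul, hc, one_mul]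

theorem Disc.moebius_inverse {c a : ℂ} (hc : ‖c‖ = 1) (ha : ‖a‖ < 1) (z : Disc) :
    Disc.moebius (norm_conj_eq_one hc) (norm_neg_mul_lt_one hc ha) (Disc.moebius hc ha z) = z :=
  Subtype.ext (_root_.moebius_inverse hc ha z.norm_lt_one)

theorem Disc.inverse_moebius {c a : ℂ} (hc : ‖c‖ = 1) (ha : ‖a‖ < 1) (z : Disc) :
    Disc.moebius hc ha (Disc.moebius (norm_conj_eq_one hc) (norm_neg_mul_lt_one hc ha) z) = z := by
  have e := Disc.moebius_inverse (norm_conj_eq_one hc) (norm_neg_mul_lt_one hc ha) z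
  have h3 : conj c * c = 1 := by rw [Complex.conj_mul', hc]; simp
  refine Subtype.ext ?_
  have e' := congrArg Subtype.val e
  simp only [Disc.coe_moebius, Complex.conj_conj] at e' ⊢
  rwa [mul_neg, neg_neg, ← mul_assoc, h3, one_mul] at e'

/-- Composition with a Möbius map on bounded holomorphic functions. -/
noncomputable def boundedHolo.comp {c a : ℂ} (hc : ‖c‖ = 1) (ha : ‖a‖ < 1) :
    boundedHolo →+* boundedHolo where
  toFun f := ⟨fun z => f.1 (Disc.moebius hc ha z), fun z => boundedHolo.extend f (moebius c a z),
    (boundedHolo.differentiableOn_extend f).comp (differentiableOn_moebius ha) fun z hz =>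
      mem_ball_zero_iff.2 (norm_moebius_lt_one hc ha (mem_ball_zero_iff.1 hz)), by
      obtain ⟨C, hC⟩ := boundedHolo.bounded_extend f
      exact ⟨C, fun z hz => hC _ (mem_ball_zero_iff.2
        (norm_moebius_lt_one hc ha (mem_ball_zero_iff.1 hz)))⟩,
    fun z => (boundedHolo.extend_apply f (Disc.moebius hc ha z)).symm⟩
  map_one' := rfl
  map_mul' _ _ := rfl
  map_zero' := rfl
  map_add' _ _ := rfl

theorem boundedHolo.comp_apply {c a : ℂ} (hc : ‖c‖ = 1) (ha : ‖a‖ < 1) (f : boundedHolo)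
    (z : Disc) : (boundedHolo.comp hc ha f).1 z = f.1 (Disc.moebius hc ha z) := rfl

/-- Composing all the entries with a Möbius map gives a similar operator. -/
theorem isConj_matOp_comp (hl : ∀ i, 1 ≤ lam i) (hmono : Monotone lam) (h : ∀ i, 0 < lam i)
    {A : Matrix (Fin n) (Fin n) boundedHolo} (hA : A.IsLowerTriangular) {c a : ℂ} (hc : ‖c‖ = 1)
    (ha : ‖a‖ < 1) : IsConj (matOp h A) (matOp h (A.map (boundedHolo.comp hc ha))) := by
  obtain ⟨W, hW⟩ := DiscSum.exists_comp_moebius hl h hc ha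
  obtain ⟨V, hV⟩ := DiscSum.exists_comp_moebius hl h (norm_conj_eq_one hc) (norm_neg_mul_lt_one hc ha)
  refine ⟨⟨W, V, ?_, ?_⟩, ?_⟩
  · ext g : 1
    refine DiscSum.ext fun i z => ?_
    change W (V g) i z = g i z
    rw [hW, hV, Disc.moebius_inverse]
  · ext g : 1
    refine DiscSum.ext fun i z => ?_
    change V (W g) i z = g i z
    rw [hV, hW, Disc.inverse_moebius]
  · have hA' : (A.map (boundedHolo.comp hc ha)).IsLowerTriangular := fun i j hij => by
      rw [Matrix.map_apply, hA hij, map_zero]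
    ext g : 1
    refine DiscSum.ext fun i z => ?_
    change W (matOp h A g) i z = matOp h (A.map (boundedHolo.comp hc ha)) (W g) i z
    rw [hW, matOp_apply hl hmono h hA, matOp_apply hl hmono h hA']
    exact Finset.sum_congr rfl fun j _ => by rw [hW, Matrix.map_apply, boundedHolo.comp_apply]

end Moebius

/-! ### Möbius transforms of triangular operators and of their adjoints -/

section Calculus

variable {n : ℕ} {lam : Fin n → ℝ}

theorem Matrix.IsLowerTriangular.mul_apply_self {R : Type*} [CommRing R]
    {A B : Matrix (Fin n) (Fin n) R} (hA : A.IsLowerTriangular) (hB : B.IsLowerTriangular)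
    (i : Fin n) : (A * B) i i = A i i * B i i := by
  rw [Matrix.mul_apply, Finset.sum_eq_single i]
  · intro k _ hk
    rcases hk.lt_or_gt with hk | hk
    · rw [hB hk, mul_zero]
    · rw [hA hk, zero_mul]
  · simp

theorem Matrix.IsLowerTriangular.mul_apply_succ {R : Type*} [CommRing R]
    {A B : Matrix (Fin n) (Fin n) R} (hA : A.IsLowerTriangular) (hB : B.IsLowerTriangular)
    {i j : Fin n} (hij : (i : ℕ) + 1 = j) :
    (A * B) j i = A j i * B i i + A j j * B j i := by
  have hlt : i < j := Fin.lt_def.2 (by omega)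
  rw [Matrix.mul_apply, Finset.sum_eq_add i j hlt.ne]
  · rintro k _ ⟨hki, hkj⟩
    rcases hki.lt_or_gt with hk | hk
    · rw [hB hk, mul_zero]
    · have h1 : (i : ℕ) < k := hk
      have h2 : (k : ℕ) ≠ j := fun e => hkj (Fin.ext e)
      have h3 : j < k := Fin.lt_def.2 (by omega)
      rw [hA h3, zero_mul]
  · simp
  · simp

theorem Matrix.IsLowerTriangular.smul {R : Type*} [CommRing R] {A : Matrix (Fin n) (Fin n) R}
    (hA : A.IsLowerTriangular) (r : R) : (r • A).IsLowerTriangular := fun i j hij => by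
  rw [Matrix.smul_apply, hA hij, smul_zero]

variable {F : Matrix (Fin n) (Fin n) boundedHolo}

/-- The Möbius transform of a matrix with the coordinate function on the diagonal. -/
theorem exists_moebius_matrix (hF : F.IsLowerTriangular) (hFd : ∀ i, F i i = boundedHolo.coord)
    (c : ℂ) {a : ℂ} (ha : ‖a‖ < 1) :
    (∀ i, IsUnit ((1 - boundedHolo.const (conj a) • F) i i)) ∧
    ∃ G : Matrix (Fin n) (Fin n) boundedHolo, G.IsLowerTriangular ∧
      (1 - boundedHolo.const (conj a) • F) * G =
        boundedHolo.const c • (F - boundedHolo.const a • 1) ∧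
      (∀ i z, (G i i).1 z = moebius c a z) ∧
      ∀ i j : Fin n, (i : ℕ) + 1 = j → ∀ z : Disc, (G j i).1 z =
        c * (1 - a * conj a) / (1 - conj a * z) ^ 2 * (F j i).1 z := by
  have hD : (1 - boundedHolo.const (conj a) • F).IsLowerTriangular :=
    Matrix.BlockTriangular.sub Matrix.blockTriangular_one (hF.smul _)
  have hDd : ∀ i z, ((1 - boundedHolo.const (conj a) • F) i i).1 z = 1 - conj a * z := by
    intro i z
    simp [hFd, boundedHolo.const_apply, boundedHolo.coord_apply]
  have hu : ∀ i, IsUnit ((1 - boundedHolo.const (conj a) • F) i i) := fun i => by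
    refine boundedHolo.isUnit (sub_pos.2 ha) fun z => ?_
    rw [hDd]
    have h1 := norm_sub_norm_le (1 : ℂ) (conj a * z)
    rw [norm_mul, RCLike.norm_conj, norm_one] at h1
    nlinarith [z.norm_lt_one, norm_nonneg a, norm_nonneg (z : ℂ)]
  refine ⟨hu, ?_⟩
  obtain ⟨E, hE, h1, h2⟩ := hD.exists_inverse hu
  have hN : (boundedHolo.const c • (F - boundedHolo.const a • 1)).IsLowerTriangular :=
    Matrix.IsLowerTriangular.smul
      (Matrix.BlockTriangular.sub hF (Matrix.IsLowerTriangular.smul Matrix.blockTriangular_one _)) _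
  have hG := Matrix.BlockTriangular.mul hE hN
  have hDG : (1 - boundedHolo.const (conj a) • F) *
      (E * boundedHolo.const c • (F - boundedHolo.const a • 1)) =
        boundedHolo.const c • (F - boundedHolo.const a • 1) := by
    rw [← mul_assoc, h1, one_mul]
  set G := E * boundedHolo.const c • (F - boundedHolo.const a • 1)
  have hdiag : ∀ i z, (G i i).1 z = moebius c a z := by
    intro i z
    have e := congrFun (congrFun hDG i) i
    rw [hD.mul_apply_self hG] at e
    have e' := congrFun (congrArg Subtype.val e) z
    have hne := one_sub_conj_mul_ne_zero ha z.norm_lt_one.le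
    rw [moebius, eq_div_iff hne]
    have e1 : (((1 - boundedHolo.const (conj a) • F) i i * G i i : boundedHolo) : Disc → ℂ) z =
        (1 - conj a * z) * (G i i).1 z := by
      rw [← hDd i z]
      rfl
    rw [e1] at e'
    rw [mul_comm, e']
    simp [hFd, boundedHolo.const_apply, boundedHolo.coord_apply]
  refine ⟨G, hG, hDG, hdiag, fun i j hij z => ?_⟩
  have hne := one_sub_conj_mul_ne_zero ha z.norm_lt_one.le
  have hji : j ≠ i := by rintro rfl; omega
  -- This entry of the equation reads (1 − āz) G_{ji} − ā F_{ji} φ = c F_{ji}, where φ is the Möbius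
  -- map; solving it produces the derivative of φ as the coefficient.
  have e := congrFun (congrFun hDG j) i
  rw [hD.mul_apply_succ hG hij] at e
  have e' := congrFun (congrArg Subtype.val e) z
  have e1 : (((1 - boundedHolo.const (conj a) • F) j i * G i i +
      (1 - boundedHolo.const (conj a) • F) j j * G j i : boundedHolo) : Disc → ℂ) z =
        -(conj a * (F j i).1 z) * moebius c a z + (1 - conj a * z) * (G j i).1 z := by
    rw [← hDd j z, ← hdiag i z]
    have : ((1 - boundedHolo.const (conj a) • F) j i).1 z = -(conj a * (F j i).1 z) := by
      simp [Matrix.one_apply_ne hji, boundedHolo.const_apply]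
    rw [← this]
    rfl
  have e2 : ((boundedHolo.const c • (F - boundedHolo.const a • 1)) j i).1 z = c * (F j i).1 z := by
    simp [Matrix.one_apply_ne hji, boundedHolo.const_apply]
  rw [e1, e2, moebius] at e'
  generalize conj a = a' at *
  have hne' : 1 - (z : ℂ) * a' ≠ 0 := by rwa [mul_comm]
  field_simp at e' ⊢
  linear_combination e'

theorem IsConj.star {M : Type*} [Monoid M] [StarMul M] {x y : M} (hxy : IsConj x y) :
    IsConj (star x) (star y) := by
  obtain ⟨u, hu⟩ := hxy.symm
  refine ⟨Star.star u, ?_⟩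
  rw [SemiconjBy, Units.coe_star, ← star_mul, ← star_mul, hu.eq]

theorem isConj_star_iff {M : Type*} [Monoid M] [StarMul M] {x y : M} :
    IsConj (star x) (star y) ↔ IsConj x y :=
  ⟨fun h => by simpa only [star_star] using h.star, IsConj.star⟩

/-- The inverse stands on the right in `moebiusOp`, which matches what the adjoint of an equation (1
− āM)G = c(M − a) provides. -/
theorem moebiusOp_eq {E : Type*} [NormedAddCommGroup E] [NormedSpace ℂ E] {c a : ℂ}
    {T V : E →L[ℂ] E} (hu : IsUnit (1 - conj a • T)) (hV : V * (1 - conj a • T) = c • (T - a • 1)) :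
    moebiusOp c a T = V := by
  rw [moebiusOp, ← smul_mul_assoc, ← hV, mul_assoc, Ring.mul_inverse_cancel _ hu, mul_one]

section Star

variable {E : Type*} [NormedAddCommGroup E] [InnerProductSpace ℂ E] [CompleteSpace E]

theorem star_one_sub_smul (b : ℂ) (S : E →L[ℂ] E) :
    star (1 - b • S) = 1 - conj b • star S := by
  rw [star_sub, star_one, star_smul]
  rfl

theorem star_smul_sub_smul_one (c a : ℂ) (S : E →L[ℂ] E) :
    star (c • (S - a • 1)) = conj c • (star S - conj a • 1) := by
  rw [star_smul, star_sub, star_smul, star_one]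
  rfl

theorem algebraMap_sub_star (b : ℂ) (S : E →L[ℂ] E) :
    algebraMap ℂ (E →L[ℂ] E) b - star S = star (conj b • 1 - S) := by
  rw [star_sub, star_smul, star_one, Algebra.algebraMap_eq_smul_one]
  simp

end Star

/-- Similarity of the adjoint of `matOp h F` with its Möbius transform, in terms of matrices. -/
theorem exists_isConj_moebiusOp_iff (hl : ∀ i, 1 ≤ lam i) (hmono : Monotone lam)
    (h : ∀ i, 0 < lam i) (hF : F.IsLowerTriangular) (hFd : ∀ i, F i i = boundedHolo.coord)
    {c a : ℂ} (hc : ‖c‖ = 1) (ha : ‖a‖ < 1) :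
    ∃ G : Matrix (Fin n) (Fin n) boundedHolo, G.IsLowerTriangular ∧
      (∀ i, G i i = boundedHolo.coord) ∧
      (∀ i j : Fin n, (i : ℕ) + 1 = j → ∀ z : Disc, (G j i).1 z = c * (1 - a * conj a) /
        (1 - conj a * moebius (conj c) (-(c * a)) z) ^ 2 *
          (F j i).1 (Disc.moebius (norm_conj_eq_one hc) (norm_neg_mul_lt_one hc ha) z)) ∧
      (IsConj (moebiusOp (conj c) (conj a) (star (matOp h F))) (star (matOp h F)) ↔
        IsConj (matOp h F) (matOp h G)) := by
  obtain ⟨hu, G, hG, hDG, hGd, hGs⟩ := exists_moebius_matrix hF hFd c ha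
  have hsm : (boundedHolo.const (conj a) • F).IsLowerTriangular := hF.smul _
  have hD : (1 - boundedHolo.const (conj a) • F).IsLowerTriangular :=
    Matrix.BlockTriangular.sub Matrix.blockTriangular_one hsm
  have h1 : matOp h (1 - boundedHolo.const (conj a) • F) = 1 - conj a • matOp h F := by
    rw [matOp_sub hl hmono h Matrix.blockTriangular_one hsm, matOp_one hl hmono,
      matOp_const_smul hl hmono h _ hF]
  have h2 : matOp h (boundedHolo.const c • (F - boundedHolo.const a • 1)) =
      c • (matOp h F - a • 1) := by
    have hone := Matrix.IsLowerTriangular.smul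
      (Matrix.blockTriangular_one (m := Fin n) (R := boundedHolo) (b := OrderDual.toDual))
      (boundedHolo.const a)
    rw [matOp_const_smul hl hmono h _ (hF.sub hone), matOp_sub hl hmono h hF hone,
      matOp_const_smul hl hmono h _ Matrix.blockTriangular_one, matOp_one hl hmono]
  have h3 : (1 - conj a • matOp h F) * matOp h G = c • (matOp h F - a • 1) := by
    rw [← h1, ← h2, ← hDG, matOp_mul hl hmono h hD hG]
  have hunit : IsUnit (1 - conj a • matOp h F) := by
    rw [← h1]
    exact isUnit_matOp hl hmono h hD hu
  have h4 : star (1 - conj a • matOp h F) = 1 - conj (conj a) • star (matOp h F) :=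
    star_one_sub_smul _ _
  have h5 : moebiusOp (conj c) (conj a) (star (matOp h F)) = star (matOp h G) := by
    refine moebiusOp_eq ?_ ?_
    · rw [← h4]
      exact hunit.star
    · rw [← h4, ← star_mul, h3]
      exact star_smul_sub_smul_one _ _ _
  -- Composition with the inverse Möbius map turns the diagonal φ back into z.
  have h6 := isConj_matOp_comp hl hmono h hG (norm_conj_eq_one hc) (norm_neg_mul_lt_one hc ha)
  refine ⟨G.map (boundedHolo.comp (norm_conj_eq_one hc) (norm_neg_mul_lt_one hc ha)),
    fun i j hij => ?_, fun i => ?_, fun i j hij z => ?_, ?_⟩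
  · rw [Matrix.map_apply, hG hij, map_zero]
  · refine Subtype.ext (funext fun z => ?_)
    rw [Matrix.map_apply, boundedHolo.comp_apply, hGd, boundedHolo.coord_apply,
      ← Disc.coe_moebius hc ha, Disc.inverse_moebius]
  · rw [Matrix.map_apply, boundedHolo.comp_apply, hGs i j hij, Disc.coe_moebius]
  · rw [h5, isConj_star_iff]
    exact ⟨fun hconj => hconj.symm.trans h6, fun hconj => (hconj.trans h6.symm).symm⟩

/-- For |μ| > 1 the matrix μ̄ − F is lower triangular with diagonal entries of modulus at least |μ|
− 1, so it is invertible over the bounded holomorphic functions. -/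
theorem spectrum_star_matOp_subset (hl : ∀ i, 1 ≤ lam i) (hmono : Monotone lam)
    (h : ∀ i, 0 < lam i) (hF : F.IsLowerTriangular) (hFd : ∀ i, F i i = boundedHolo.coord) :
    spectrum ℂ (star (matOp h F)) ⊆ closedBall 0 1 := by
  intro μ hμ
  by_contra hμ1
  rw [mem_closedBall_zero_iff, not_le] at hμ1
  refine (spectrum.mem_iff.1 hμ) ?_
  have hone := Matrix.IsLowerTriangular.smul
    (Matrix.blockTriangular_one (m := Fin n) (R := boundedHolo) (b := OrderDual.toDual))
    (boundedHolo.const (conj μ))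
  have h1 : matOp h (boundedHolo.const (conj μ) • 1 - F) = conj μ • 1 - matOp h F := by
    rw [matOp_sub hl hmono h hone hF, matOp_const_smul hl hmono h _ Matrix.blockTriangular_one,
      matOp_one hl hmono]
  have h2 : algebraMap ℂ (DiscSum lam h →L[ℂ] DiscSum lam h) μ - star (matOp h F) =
      star (matOp h (boundedHolo.const (conj μ) • 1 - F)) := by
    rw [h1]
    exact algebraMap_sub_star _ _
  rw [h2]
  refine (isUnit_matOp hl hmono h (hone.sub hF) fun i => ?_).star
  refine boundedHolo.isUnit (sub_pos.2 hμ1) fun z => ?_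
  have e : ((boundedHolo.const (conj μ) • (1 : Matrix (Fin n) (Fin n) boundedHolo) - F) i i).1 z =
      conj μ - z := by
    simp [hFd, boundedHolo.const_apply, boundedHolo.coord_apply]
  rw [e]
  have := norm_sub_norm_le (conj μ) (z : ℂ)
  rw [RCLike.norm_conj] at this
  linarith [z.norm_lt_one]

end Calculus

/-! ### The given operator as the adjoint of a matrix multiplication -/

section Symbols

/-- The lower triangular matrix of bounded holomorphic functions with transposed entries `f i j`
off the diagonal and the coordinate function on it. -/
noncomputable def symbolMatrix {n : ℕ} (f : Fin n → Fin n → ℂ → ℂ)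
    (hf : ∀ i j : Fin n, i < j → DifferentiableOn ℂ (f i j) (ball 0 1) ∧
      ∃ C : ℝ, ∀ z ∈ ball (0 : ℂ) 1, ‖f i j z‖ ≤ C) : Matrix (Fin n) (Fin n) boundedHolo :=
  Matrix.of fun i j => if h : j < i then boundedHolo.ofFun (f j i) (hf j i h).1 (hf j i h).2
    else if i = j then boundedHolo.coord else 0

variable {n : ℕ} {f : Fin n → Fin n → ℂ → ℂ}
  (hf : ∀ i j : Fin n, i < j → DifferentiableOn ℂ (f i j) (ball 0 1) ∧
    ∃ C : ℝ, ∀ z ∈ ball (0 : ℂ) 1, ‖f i j z‖ ≤ C)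

theorem symbolMatrix_isLowerTriangular : (symbolMatrix f hf).IsLowerTriangular := by
  intro i j hij
  have hij : i < j := hij
  simp [symbolMatrix, hij.not_gt, hij.ne]

theorem symbolMatrix_diag (i : Fin n) : symbolMatrix f hf i i = boundedHolo.coord := by
  simp [symbolMatrix]

theorem symbolMatrix_apply {i j : Fin n} (hij : i < j) (z : Disc) :
    (symbolMatrix f hf j i).1 z = f i j z := by
  simp [symbolMatrix, hij, boundedHolo.ofFun_apply]

theorem symbolMatrix_apply_symbol {i j : Fin n} (hij : i ≤ j) (z : Disc) :
    (symbolMatrix f hf j i).1 z = symbol f i j z := by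
  rcases hij.eq_or_lt with rfl | hij
  · simp [symbolMatrix_diag, boundedHolo.coord_apply, symbol]
  · rw [symbolMatrix_apply hf hij, symbol, if_neg hij.ne]

theorem triangularOp_eq {lam : Fin n → ℝ} (hl : ∀ i, 1 ≤ lam i) (hmono : Monotone lam)
    (h : ∀ i, 0 < lam i) :
    triangularOp (fun i => DiscSpace (lam i) (h i)) f = star (matOp h (symbolMatrix f hf)) := by
  rw [ContinuousLinearMap.star_eq_adjoint, matOp, adjoint_blockOp, triangularOp]
  congr 1
  funext i j
  have hm := isMultiplier_extend hl hmono h (symbolMatrix_isLowerTriangular hf) j i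
  split_ifs with hij
  · rw [mulOp_congr hm fun z => ?_]
    rw [boundedHolo.extend_apply, symbolMatrix_apply_symbol hf hij]
  · have : mulOp (DiscSpace (lam i) (h i)) (DiscSpace (lam j) (h j))
        (boundedHolo.extend (symbolMatrix f hf j i)) = 0 := by
      ext g : 1
      refine RKHS.ext fun z => ?_
      rw [mulOp_apply hm, boundedHolo.extend_apply,
        symbolMatrix_isLowerTriangular hf (lt_of_not_ge hij)]
      simp
    rw [this, map_zero]

end Symbols

/-! ### Propagation of zeros under Möbius maps -/

section DiscAlgebra

theorem eqOn_zero_closedBall {f : ℂ → ℂ} (hc : ContinuousOn f (closedBall 0 1))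
    (h : ∀ z ∈ ball (0 : ℂ) 1, f z = 0) : ∀ z ∈ closedBall (0 : ℂ) 1, f z = 0 := by
  have h1 : Set.EqOn f 0 (ball 0 1) := h
  refine h1.of_subset_closure hc continuousOn_const ball_subset_closedBall ?_
  rw [closure_ball _ one_ne_zero]

/-- A function in the disc algebra with `|f ∘ θ| ≤ C |f|` for every Möbius map `θ` has no zeros
unless it vanishes identically. -/
theorem ne_zero_of_norm_comp_moebius_le {f : ℂ → ℂ} (hc : ContinuousOn f (closedBall 0 1))
    (hd : DifferentiableOn ℂ f (ball 0 1)) (h0 : ∃ z ∈ closedBall (0 : ℂ) 1, f z ≠ 0)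
    (h : ∀ c a : ℂ, ‖c‖ = 1 → ‖a‖ < 1 → ∃ C : ℝ, ∀ z ∈ ball (0 : ℂ) 1,
      ‖f (moebius (conj c) (-(c * a)) z)‖ ≤ C * ‖f z‖) :
    ∀ z ∈ closedBall (0 : ℂ) 1, f z ≠ 0 := by
  intro z₀ hz₀ hfz₀
  obtain ⟨z₁, hz₁, hfz₁⟩ := h0
  rcases (mem_closedBall_zero_iff.1 hz₀).eq_or_lt with hn | hn
  -- A zero on the circle is carried to every point of the circle by rotations, the inequality
  -- extending to the closed disc by continuity; the maximum principle then gives f = 0.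
  · have hsphere : ∀ w : ℂ, ‖w‖ = 1 → f w = 0 := by
      intro w hw
      have hz0 : z₀ ≠ 0 := by rintro rfl; simp at hn
      have hcn : ‖conj (w / z₀)‖ = 1 := by rw [RCLike.norm_conj, norm_div, hw, hn, div_one]
      obtain ⟨C, hC⟩ := h (conj (w / z₀)) 0 hcn (by simp)
      have hm : ∀ z, moebius (conj (conj (w / z₀))) (-(conj (w / z₀) * 0)) z = w / z₀ * z := by
        intro z
        simp [moebius]
      simp only [hm] at hC
      have hmaps : Set.MapsTo (fun z => w / z₀ * z) (closedBall (0 : ℂ) 1) (closedBall 0 1) := by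
        intro z hz
        rw [mem_closedBall_zero_iff] at hz ⊢
        rwa [norm_mul, norm_div, hw, hn, div_one, one_mul]
      have hc' : ContinuousOn (fun z => ‖f (w / z₀ * z)‖) (closedBall 0 1) :=
        (hc.comp (by fun_prop) hmaps).norm
      have hle := le_on_closure (s := ball (0 : ℂ) 1) hC
        (by rwa [closure_ball _ one_ne_zero])
        (by rw [closure_ball _ one_ne_zero]; exact hc.norm.const_mul C)
        (x := z₀) (by rwa [closure_ball _ one_ne_zero])
      rw [hfz₀, norm_zero, mul_zero, div_mul_cancel₀ _ hz0] at hle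
      exact norm_le_zero_iff.1 hle
    have hdc : DiffContOnCl ℂ f (ball 0 1) :=
      ⟨hd, by rwa [closure_ball _ one_ne_zero]⟩
    have := Complex.norm_le_of_forall_mem_frontier_norm_le (U := ball (0 : ℂ) 1) (C := 0)
      isBounded_ball hdc (fun z hz => by
        rw [frontier_ball _ one_ne_zero, mem_sphere_zero_iff_norm] at hz
        rw [hsphere z hz, norm_zero]) (by rwa [closure_ball _ one_ne_zero] : z₁ ∈ closure (ball 0 1))
    exact hfz₁ (norm_le_zero_iff.1 this)
  -- A zero inside is first moved to 0 by the Möbius map sending `z₀` to 0, and from there to any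
  -- `w` by one sending 0 to `w`.
  · have h00 : f 0 = 0 := by
      obtain ⟨C, hC⟩ := h 1 (-z₀) norm_one (by rwa [norm_neg])
      have := hC z₀ (mem_ball_zero_iff.2 hn)
      rw [hfz₀, norm_zero, mul_zero, norm_le_zero_iff] at this
      simpa [moebius] using this
    refine hfz₁ (eqOn_zero_closedBall hc (fun w hw => ?_) z₁ hz₁)
    obtain ⟨C, hC⟩ := h 1 w norm_one (mem_ball_zero_iff.1 hw)
    have := hC 0 (mem_ball_self one_pos)
    rw [h00, norm_zero, mul_zero, norm_le_zero_iff] at this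
    simpa [moebius] using this

end DiscAlgebra

/-- The numerator has modulus 1 − |a|² and the denominator at most 4. Being uniform, the bound lets
the derivative factor be cancelled in estimates and preserves units. -/
theorem le_norm_moebius_factor {c a : ℂ} (hc : ‖c‖ = 1) (ha : ‖a‖ < 1) {w : ℂ} (hw : ‖w‖ < 1) :
    (1 - ‖a‖ ^ 2) / 4 ≤ ‖c * (1 - a * conj a) / (1 - conj a * w) ^ 2‖ := by
  have h1 := norm_pos_iff.2 (one_sub_conj_mul_ne_zero ha hw.le)
  have h2 : ‖1 - conj a * w‖ ≤ 2 := by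
    refine (norm_sub_le _ _).trans ?_
    have : ‖conj a * w‖ < 1 := norm_mul_lt_one (by rwa [RCLike.norm_conj]) hw
    rw [norm_one]
    linarith
  have h3 : 0 ≤ 1 - ‖a‖ ^ 2 := by nlinarith [norm_nonneg a]
  have h4 : ‖1 - a * conj a‖ = 1 - ‖a‖ ^ 2 := by
    rw [Complex.mul_conj', ← Complex.ofReal_one, ← Complex.ofReal_pow, ← Complex.ofReal_sub,
      Complex.norm_real, Real.norm_of_nonneg h3]
  rw [norm_div, norm_mul, hc, one_mul, h4, norm_pow]
  gcongr
  nlinarith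

/-! ### The equivalence -/

theorem proposition5p4 (n : ℕ) (lam : Fin n → ℝ) (hlam : ∀ i, 1 ≤ lam i)
    (hstep : ∀ i j : Fin n, (i : ℕ) + 1 = j → lam i ≤ lam j ∧ lam j < lam i + 2)
    (f : Fin n → Fin n → ℂ → ℂ)
    -- the superdiagonal symbols are nonzero elements of the disc algebra
    (hsuper : ∀ i j : Fin n, (i : ℕ) + 1 = j →
      ContinuousOn (f i j) (closedBall 0 1) ∧ DifferentiableOn ℂ (f i j) (ball 0 1) ∧
        ∃ z ∈ closedBall (0 : ℂ) 1, f i j z ≠ 0)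
    -- the symbols further above the diagonal are bounded holomorphic functions
    (hupper : ∀ i j : Fin n, (i : ℕ) + 2 ≤ j →
      DifferentiableOn ℂ (f i j) (ball 0 1) ∧ ∃ C : ℝ, ∀ z ∈ ball (0 : ℂ) 1, ‖f i j z‖ ≤ C) :
    -- all entries of the operator are well defined, bounded operators
    (∀ i j : Fin n, i ≤ j →
      IsMultiplier (DiscSpace (lam i) (one_pos.trans_le (hlam i)))
        (DiscSpace (lam j) (one_pos.trans_le (hlam j))) (symbol f i j)) ∧
    (WeaklyHomogeneous
        (triangularOp (fun i => DiscSpace (lam i) (one_pos.trans_le (hlam i))) f) ↔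
      ∀ i j : Fin n, (i : ℕ) + 1 = j → ∀ z ∈ closedBall (0 : ℂ) 1, f i j z ≠ 0) := by
  have hmono : Monotone lam := by
    rcases n with _ | n
    · exact fun i => i.elim0
    · exact Fin.monotone_iff_le_succ.2 fun i => (hstep _ _ (by simp)).1
  have h : ∀ i, 0 < lam i := fun i => one_pos.trans_le (hlam i)
  have hf : ∀ i j : Fin n, i < j → DifferentiableOn ℂ (f i j) (ball 0 1) ∧
      ∃ C : ℝ, ∀ z ∈ ball (0 : ℂ) 1, ‖f i j z‖ ≤ C := by
    intro i j hij
    have hij' : (i : ℕ) < j := hij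
    rcases Nat.lt_or_ge ((i : ℕ) + 1) j with h2 | h2
    · exact hupper i j h2
    · obtain ⟨hc, hd, -⟩ := hsuper i j (by omega)
      obtain ⟨C, hC⟩ := (isCompact_closedBall (0 : ℂ) 1).exists_bound_of_continuousOn hc
      exact ⟨hd, C, fun z hz => hC z (ball_subset_closedBall hz)⟩
  set F := symbolMatrix f hf
  have hF : F.IsLowerTriangular := symbolMatrix_isLowerTriangular hf
  have hFd : ∀ i, F i i = boundedHolo.coord := symbolMatrix_diag hf
  have hlt : ∀ {i j : Fin n}, (i : ℕ) + 1 = j → i < j := fun hij => Fin.lt_def.2 (by omega)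
  have hFs : ∀ i j : Fin n, (i : ℕ) + 1 = j → ∀ z : Disc, (F j i).1 z = f i j z :=
    fun i j hij z => symbolMatrix_apply hf (hlt hij) z
  have hF0 : ∀ i j : Fin n, (i : ℕ) + 1 = j → ∃ z, (F j i).1 z ≠ 0 := by
    intro i j hij
    obtain ⟨hc, -, z, hz, hfz⟩ := hsuper i j hij
    by_contra! hall
    exact hfz (eqOn_zero_closedBall hc (fun w hw => by
      rw [← hall ⟨w, hw⟩, hFs i j hij]) z hz)
  refine ⟨fun i j hij => ?_, ?_⟩
  · have hm := isMultiplier_extend hlam hmono h hF j i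
    obtain ⟨M, hM⟩ := hm
    refine ⟨M, fun g z => ?_⟩
    rw [hM, boundedHolo.extend_apply, symbolMatrix_apply_symbol hf hij]
  rw [triangularOp_eq hf hlam hmono h]
  constructor
  · rintro ⟨-, hconj⟩ i j hij
    obtain ⟨hc, hd, h0⟩ := hsuper i j hij
    refine ne_zero_of_norm_comp_moebius_le hc hd h0 fun c a hc1 ha => ?_
    obtain ⟨G, hG, hGd, hGs, hiff⟩ := exists_isConj_moebiusOp_iff hlam hmono h hF hFd hc1 ha
    have hFG := hiff.1 (hconj _ _ (norm_conj_eq_one hc1) (by rwa [RCLike.norm_conj]))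
    have hpos : 0 < (1 - ‖a‖ ^ 2) / 4 := by
      have : 0 < 1 - ‖a‖ ^ 2 := by nlinarith [norm_nonneg a]
      positivity
    have hfac : ∀ z : Disc, (1 - ‖a‖ ^ 2) / 4 ≤
        ‖c * (1 - a * conj a) / (1 - conj a * moebius (conj c) (-(c * a)) z) ^ 2‖ := fun z =>
      le_norm_moebius_factor hc1 ha (Disc.moebius (norm_conj_eq_one hc1)
        (norm_neg_mul_lt_one hc1 ha) z).norm_lt_one
    have hG0 : ∀ i j : Fin n, (i : ℕ) + 1 = j → ∃ z, (G j i).1 z ≠ 0 := by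
      intro i j hij
      obtain ⟨w, hw⟩ := hF0 i j hij
      refine ⟨Disc.moebius hc1 ha w, ?_⟩
      rw [hGs i j hij, Disc.moebius_inverse]
      exact mul_ne_zero (norm_pos_iff.1 (hpos.trans_le (hfac _))) hw
    obtain ⟨C, hC⟩ := exists_norm_subdiag_le hlam hmono (fun i j hij => (hstep i j hij).2) hF hG
      hFd hGd hF0 hG0 hFG hij
    refine ⟨((1 - ‖a‖ ^ 2) / 4)⁻¹ * C, fun z hz => ?_⟩
    have h1 := hC ⟨z, hz⟩
    rw [hGs i j hij, hFs i j hij, hFs i j hij, norm_mul] at h1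
    -- Cancelling the derivative factor leaves the comparison of `f i j` composed with the inverse
    -- Möbius map and `f i j` itself.
    have h2 := (mul_le_mul_of_nonneg_right (hfac ⟨z, hz⟩) (norm_nonneg _)).trans h1
    rw [mul_assoc]
    exact (le_inv_mul_iff₀ hpos).2 h2
  · intro hne
    refine ⟨spectrum_star_matOp_subset hlam hmono h hF hFd, fun c a hc1 ha => ?_⟩
    have hc' : ‖conj c‖ = 1 := norm_conj_eq_one hc1
    have ha' : ‖conj a‖ < 1 := by rwa [RCLike.norm_conj]
    -- Passing to adjoints conjugates the coefficients, so conjugated ones are supplied here.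
    obtain ⟨G, hG, hGd, hGs, hiff⟩ := exists_isConj_moebiusOp_iff hlam hmono h hF hFd hc' ha'
    rw [Complex.conj_conj, Complex.conj_conj] at hiff
    refine hiff.2 ?_
    -- By compactness, having no zero on the closed disc means being bounded below, which is
    -- invertibility in the ring.
    have hlow : ∀ i j : Fin n, (i : ℕ) + 1 = j → ∃ ε > 0, ∀ z, ε ≤ ‖(F j i).1 z‖ := by
      intro i j hij
      obtain ⟨z₀, hz₀, hmin⟩ := (isCompact_closedBall (0 : ℂ) 1).exists_isMinOn
        ⟨0, mem_closedBall_self zero_le_one⟩ (hsuper i j hij).1.norm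
      refine ⟨‖f i j z₀‖, norm_pos_iff.2 (hne i j hij z₀ hz₀), fun z => ?_⟩
      rw [hFs i j hij]
      exact hmin (ball_subset_closedBall z.2)
    have hpos : 0 < (1 - ‖conj a‖ ^ 2) / 4 := by
      have : 0 < 1 - ‖conj a‖ ^ 2 := by
        rw [RCLike.norm_conj]
        nlinarith [norm_nonneg a]
      positivity
    obtain ⟨P, Q, hP, hQ, hPQ, hQP, hFP⟩ := hF.exists_conj hG hFd hGd
      (fun i j hij => by
        obtain ⟨ε, hε, hle⟩ := hlow i j hij
        exact boundedHolo.isUnit hε hle)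
      (fun i j hij => by
        obtain ⟨ε, hε, hle⟩ := hlow i j hij
        refine boundedHolo.isUnit (mul_pos hpos hε) fun z => ?_
        rw [hGs i j hij, norm_mul]
        refine mul_le_mul ?_ (hle _) hε.le (norm_nonneg _)
        exact le_norm_moebius_factor hc' ha' (Disc.moebius (norm_conj_eq_one hc')
          (norm_neg_mul_lt_one hc' ha') z).norm_lt_one)
    refine IsConj.symm ⟨⟨matOp h P, matOp h Q, ?_, ?_⟩, ?_⟩
    · rw [← matOp_mul hlam hmono h hP hQ, hPQ, matOp_one hlam hmono]
    · rw [← matOp_mul hlam hmono h hQ hP, hQP, matOp_one hlam hmono]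
    · change matOp h P * matOp h G = matOp h F * matOp h P
      rw [← matOp_mul hlam hmono h hP hG, ← matOp_mul hlam hmono h hF hP, hFP]
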